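/- **Setting.** Let $\mathcal X\subset\mathbb R^{p}$, let $U$ be a probability distribution on $\mathcal X$, and let $x_1,x_2,\dots$ be i.i.d. from $U$, $X_n=(x_1,\dots,x_n)$. Let $C(\cdot,\cdot;\theta)$, $\theta\in\Theta$ ($\Theta\subset\mathbb R^q$, or any topological space), be measurable covariance (symmetric positive semidefinite) kernels on $\mathcal X$. Let $H$ be a probability distribution on $(0,\infty)$ and $\kappa:(0,\infty)\to(0,\infty)$ a measurable function with $\int \max\{0,-\log\kappa(r)\}\,dH(r)<\infty$ (for $\kappa(r)=1/r$ this holds whenever $\int r\,dH(r)<\infty$, e.g. for the Student-$t$, slash and contaminated-normal processes). Let $\phi>0$ be the error variance, $\mu$ the mean function, $t_1,\dots,t_n$ observation points (which may change with $n$), and let $\tau_0:\mathcal X\to\mathbb R$ be a fixed function. *True model:* given $\tau_0$ and $X_n$, $y_i=\mu(t_i)+\tau_0(x_i)+\varepsilon_i$ for $i\le n$, where $r\sim H$ and $(\varepsilon_1,\dots,\varepsilon_n)\mid r\sim N(0,\kappa(r)\phi I_n)$; its density is $$p(y_n\mid\tau_0,X_n)=\int N\big(y_n;\,\mu(t_\cdot)+\tau_0(x_\cdot),\,\kappa(r)\phi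 I_n\big)\,dH(r).$$ *Heavy-tailed process functional regression (HPFR) model with parameter $\theta$:* $y_i=\mu(t_i)+\tau(x_i)+\varepsilon_i$, where, given $r\sim H$, $\tau$ is a centred Gaussian process with covariance $\kappa(r)C(\cdot,\cdot;\theta)$, independent of $(\varepsilon_1,\dots,\varepsilon_n)\sim N(0,\kappa(r)\phi I_n)$; its marginal density is $$p_\theta(y_n\mid X_n)=\int\!\!\int N\big(y_n;\,\mu(t_\cdot)+\tau(x_\cdot),\,\kappa(r)\phi I_n\big)\,dP_{\theta}(\tau\mid r)\,dH(r).$$ Write $C_n=(C(x_i,x_j;\theta_0))_{i,j\le n}$ and $D[p_1,p_2]=\int(\log p_1-\log p_2)\,dp_1$ for the Kullback–Leibler divergence. **Theorem 1 (information consistency).** Let $\theta_0\in\Theta$ and let $\widehat\theta_n$ be a sequence of $\Theta$-valued random elements (the estimates of $\theta_0$). Assume: - (C1) $C(\cdot,\cdot;\theta)$ is continuous in $\theta$ for the supremum norm on $\mathcal X\times\mathcal X$, and $\widehat\theta_n\to\theta_0$ almost surely as $n\to\infty$; - (C2) $\tau_0$ lies in the reproducing kernel Hilbert space of $C(\cdot,\cdot;\theta_0)$,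 with finite norm; - (C3) $E_{X_n}\log|I_n+\phi^{-1}C_n|=o(n)$. Then, almost surely with respect to the randomness of $(\widehat\theta_n)$, $$\frac1n\,E_{X_n}\Big(D\big[p(y_n\mid\tau_0,X_n),\,p_{\widehat\theta_n}(y_n\mid X_n)\big]\Big)\to0\qquad(n\to\infty),$$ where $p_{\widehat\theta_n}$ is $p_\theta$ with the realized value of $\widehat\theta_n$ plugged in for $\theta$, and $E_{X_n}$ is the expectation over the distribution $U^{\otimes n}$ of $X_n$ only. -/

import Mathlib

open MeasureTheory ProbabilityTheory Filter Topology
open scoped ENNReal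

noncomputable section

namespace HPFR

variable {𝒳 : Type}

/-- `K` is a covariance kernel: symmetric, with all finite Gram matrices positive semidefinite. -/
def IsCovKernel (K : 𝒳 → 𝒳 → ℝ) : Prop :=
  (Matrix.of K).PosSemidef

/-- `f` belongs to the reproducing kernel Hilbert space of `K` and its RKHS norm is at most `B`. -/
def RKHSNormLE (K : 𝒳 → 𝒳 → ℝ) (f : 𝒳 → ℝ) (B : ℝ) : Prop :=
  ∃ (F : Type) (_ : NormedAddCommGroup F) (_ : InnerProductSpace ℝ F) (_ : CompleteSpace F)
    (_ : RKHS ℝ F 𝒳 ℝ),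
    (∀ x x' : 𝒳, RKHS.kernel F x x' 1 = K x x') ∧ ∃ g : F, ⇑g = f ∧ ‖g‖ ≤ B

/-- The covariance matrix `Cₙ = (K(xᵢ, xⱼ))ᵢⱼ` at the design points `X = (x₁, …, xₙ)`. -/
def gram (K : 𝒳 → 𝒳 → ℝ) {n : ℕ} (X : Fin n → 𝒳) : Matrix (Fin n) (Fin n) ℝ :=
  Matrix.of fun i j => K (X i) (X j)

/-- The density at `y` of `N(a, v Iₙ)`. -/
def isoGaussianDensity {n : ℕ} (a : Fin n → ℝ) (v : ℝ) (y : Fin n → ℝ) : ℝ≥0∞ :=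
  ∏ i, gaussianPDF (a i) v.toNNReal (y i)

/-- The density `p(yₙ | τ₀, Xₙ)` of the true model `yᵢ = mᵢ + τ₀(xᵢ) + εᵢ`, where
`ε | r ∼ N(0, κ(r) φ Iₙ)` and `r ∼ H`; here `mᵢ = μ(tᵢ)`. -/
def trueDensity (H : Measure ℝ) (κ : ℝ → ℝ) (φ : ℝ) (τ₀ : 𝒳 → ℝ) {n : ℕ} (m : Fin n → ℝ)
    (X : Fin n → 𝒳) (y : Fin n → ℝ) : ℝ≥0∞ :=
  ∫⁻ r, isoGaussianDensity (fun i => m i + τ₀ (X i)) (κ r * φ) y ∂H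

/-- The marginal density of `yₙ` given `Xₙ` under the heavy-tailed process model with kernel `K`:
`yᵢ = mᵢ + τ(xᵢ) + εᵢ`, where, given `r ∼ H`, the process `τ` and the error `ε` are independent,
`τ` is a centred Gaussian process with covariance `κ(r) K`, so that
`(τ(x₁), …, τ(xₙ)) | r ∼ N(0, κ(r) Cₙ)`, and `ε | r ∼ N(0, κ(r) φ Iₙ)`. -/
def modelDensity (H : Measure ℝ) (κ : ℝ → ℝ) (φ : ℝ) (K : 𝒳 → 𝒳 → ℝ) {n : ℕ} (m : Fin n → ℝ)
    (X : Fin n → 𝒳) (y : Fin n → ℝ) : ℝ≥0∞ :=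
  ∫⁻ r, ∫⁻ τ : EuclideanSpace ℝ (Fin n),
    isoGaussianDensity (fun i => m i + τ i) (κ r * φ) y
      ∂(multivariateGaussian 0 (κ r • gram K X)) ∂H

/-- The Kullback–Leibler divergence `D[p₁, p₂] = ∫ (log p₁ - log p₂) dp₁` of two densities on `ℝⁿ`
(with value `∞` when the integral is not defined). -/
def klDensity {n : ℕ} (p₁ p₂ : (Fin n → ℝ) → ℝ≥0∞) : ℝ≥0∞ :=
  InformationTheory.klDiv (volume.withDensity p₁) (volume.withDensity p₂)

/-- The expected regret `E_{Xₙ} log |Iₙ + φ⁻¹ Cₙ|`, for `x₁, …, xₙ` i.i.d. from `U`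
(the integrand is nonnegative). -/
def expectedRegret [MeasurableSpace 𝒳] (U : Measure 𝒳) (φ : ℝ) (K : 𝒳 → 𝒳 → ℝ) (n : ℕ) : ℝ≥0∞ :=
  ∫⁻ X : Fin n → 𝒳, ENNReal.ofReal (Real.log (1 + φ⁻¹ • gram K X).det) ∂(Measure.pi fun _ => U)

/-- `E_{Xₙ} D[p(yₙ | τ₀, Xₙ), p_K(yₙ | Xₙ)]`, for `x₁, …, xₙ` i.i.d. from `U`. -/
def expectedKL [MeasurableSpace 𝒳] (U : Measure 𝒳) (H : Measure ℝ) (κ : ℝ → ℝ) (φ : ℝ)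
    (τ₀ : 𝒳 → ℝ) (K : 𝒳 → 𝒳 → ℝ) {n : ℕ} (m : Fin n → ℝ) : ℝ≥0∞ :=
  ∫⁻ X : Fin n → 𝒳, klDensity (trueDensity H κ φ τ₀ m X) (modelDensity H κ φ K m X)
    ∂(Measure.pi fun _ => U)

end HPFR

end

/-!
Diagonalising the Gram matrix of the plugged-in kernel `Kₙ` by an orthogonal change of coordinates
turns both models into mixtures over `r` of product Gaussians whose variances scale with `κ r`.
By joint convexity the divergence of the mixtures is at most the average divergence of the
components, which is `log det (I + φ⁻¹ Cₙ) / 2` plus a signal term bounded by the RKHS norm of `τ₀`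
divided by `κ r`. That term is not integrable in `r`, so the components with `κ r < ε` are compared
instead with a part of the model mixture in which `κ` lies in a fixed window `[a, b]`; this costs
`n (log b - log (κ r))` per component, and `∫ max (0, -log κ) dH < ∞` makes its average at most
`n` times an arbitrarily small constant.

The kernel `Kₙ` is only uniformly close to `C(·, ·; θ₀)`, which on `n` points is useless for
comparing log-determinants: the error is of order `n²`. But by Fischer's inequality the expected
regret is subadditive in `n`, so its value at `n` is controlled by the one at a fixed block length,
where uniform closeness suffices.
-/

noncomputable section

namespace HPFR

section LinearAlgebra

open Matrix
open scoped MatrixOrder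

variable {ι : Type*} [Fintype ι] [DecidableEq ι]

lemma exists_orthogonal_diagonalization {S : Matrix ι ι ℝ} (hS : S.PosSemidef) :
    ∃ (O : Matrix ι ι ℝ) (l : ι → ℝ), Oᵀ * O = 1 ∧ (∀ i, 0 ≤ l i) ∧
      S = O * diagonal l * Oᵀ := by
  refine ⟨hS.1.eigenvectorUnitary, hS.1.eigenvalues, ?_, hS.eigenvalues_nonneg, ?_⟩
  · have := Unitary.coe_star_mul_self hS.1.eigenvectorUnitary
    rwa [star_eq_conjTranspose, conjTranspose_eq_transpose_of_trivial] at this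
  · conv_lhs => rw [hS.1.spectral_theorem]
    rw [Unitary.conjStarAlgAut_apply, star_eq_conjTranspose,
      conjTranspose_eq_transpose_of_trivial]
    rfl

lemma det_one_add_smul_of_diagonalization {O : Matrix ι ι ℝ} {l : ι → ℝ} (hO : Oᵀ * O = 1)
    (c : ℝ) : (1 + c • (O * diagonal l * Oᵀ)).det = ∏ i, (1 + c * l i) := by
  have hO' : O * Oᵀ = 1 := mul_eq_one_comm.1 hO
  have hconj : 1 + c • (O * diagonal l * Oᵀ) = O * diagonal (fun i => 1 + c * l i) * Oᵀ := by
    have hdiag : diagonal (fun i => 1 + c * l i) = 1 + c • diagonal l := by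
      ext i j; by_cases hij : i = j <;> simp [hij]
    rw [hdiag, Matrix.mul_add, Matrix.add_mul, Matrix.mul_one, hO']
    simp
  rw [hconj, det_mul_right_comm, hO', one_mul, det_diagonal]

lemma log_det_le_trace_sub_card {W : Matrix ι ι ℝ} (hW : W.PosDef) :
    Real.log W.det ≤ W.trace - Fintype.card ι := by
  have hdet : W.det = ∏ i, hW.1.eigenvalues i := by simpa using hW.1.det_eq_prod_eigenvalues
  have htr : W.trace = ∑ i, hW.1.eigenvalues i := by simpa using hW.1.trace_eq_sum_eigenvalues
  rw [hdet, htr, Real.log_prod fun i _ => (hW.eigenvalues_pos i).ne']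
  calc ∑ i, Real.log (hW.1.eigenvalues i) ≤ ∑ i, (hW.1.eigenvalues i - 1) :=
        Finset.sum_le_sum fun i _ => Real.log_le_sub_one_of_pos (hW.eigenvalues_pos i)
    _ = ∑ i, hW.1.eigenvalues i - Fintype.card ι := by simp [Finset.sum_sub_distrib]

lemma log_det_add_log_det_le {A M : Matrix ι ι ℝ} (hA : A.PosDef) (hM : M.PosDef) :
    Real.log A.det + Real.log M.det ≤ (M * A).trace - Fintype.card ι := by
  set R := CFC.sqrt M
  have hRR : R * R = M := CFC.sqrt_mul_sqrt_self M hM.posSemidef.nonneg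
  have hdet : (R * A * R).det = A.det * M.det := by
    rw [← hRR, det_mul, det_mul, det_mul]; ring
  have hpos : 0 < A.det * M.det := mul_pos hA.det_pos hM.det_pos
  have hR : Rᴴ = R := (CFC.sqrt_nonneg M).posSemidef.1
  have hRAR : (R * A * R).PosSemidef := by
    simpa only [hR] using hA.posSemidef.conjTranspose_mul_mul_same R
  have htr : (R * A * R).trace = (M * A).trace := by
    rw [trace_mul_comm, ← Matrix.mul_assoc, hRR]
  rw [← Real.log_mul hA.det_pos.ne' hM.det_pos.ne', ← hdet, ← htr]
  exact log_det_le_trace_sub_card (hRAR.posDef_iff_det_ne_zero.2 (hdet ▸ hpos.ne'))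

lemma abs_inv_one_add_apply_le_one {S : Matrix ι ι ℝ} (hS : S.PosSemidef) (i j : ι) :
    |(1 + S)⁻¹ i j| ≤ 1 := by
  have hu : IsUnit (1 + S).det :=
    isUnit_iff_ne_zero.2 (PosDef.one.add_posSemidef hS).det_pos.ne'
  set w : ι → ℝ := fun k => (1 + S)⁻¹ k j
  have hw : (1 + S) *ᵥ w = Pi.single j 1 := by
    have hcol : w = (1 + S)⁻¹ *ᵥ Pi.single j 1 := by rw [mulVec_single_one]; rfl
    rw [hcol, mulVec_mulVec, mul_nonsing_inv _ hu, one_mulVec]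
  have hself : w ⬝ᵥ w + w ⬝ᵥ (S *ᵥ w) = w j := by
    rw [← dotProduct_add, ← one_mulVec w, mulVec_mulVec, Matrix.mul_one, ← add_mulVec, hw,
      one_mulVec, dotProduct_single_one]
  have hnonneg : 0 ≤ w ⬝ᵥ (S *ᵥ w) := by simpa using hS.dotProduct_mulVec_nonneg w
  have hle : ∀ k, w k * w k ≤ w ⬝ᵥ w := fun k =>
    Finset.single_le_sum (f := fun k => w k * w k) (fun k _ => mul_self_nonneg _)
      (Finset.mem_univ k)
  have hj : w j ≤ 1 := by nlinarith [hle j]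
  exact abs_le.2 (abs_le_of_sq_le_sq' (by nlinarith [hle i] : w i ^ 2 ≤ 1 ^ 2) zero_le_one)

lemma trace_inv_one_add_mul_le {S T : Matrix ι ι ℝ} (hS : S.PosSemidef)
    {d : ℝ} (hd : ∀ i j, |T i j - S i j| ≤ d) :
    ((1 + S)⁻¹ * (1 + T)).trace ≤ Fintype.card ι + Fintype.card ι ^ 2 * d := by
  have hu : IsUnit (1 + S).det :=
    isUnit_iff_ne_zero.2 (PosDef.one.add_posSemidef hS).det_pos.ne'
  have hsplit : 1 + T = (1 + S) + (T - S) := by abel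
  have hentry : ∀ i j, (1 + S)⁻¹ i j * (T - S) j i ≤ d := fun i j =>
    calc (1 + S)⁻¹ i j * (T - S) j i ≤ |(1 + S)⁻¹ i j| * |T j i - S j i| := by
          rw [← abs_mul]; exact le_abs_self _
      _ ≤ 1 * d := mul_le_mul (abs_inv_one_add_apply_le_one hS i j) (hd j i)
          (abs_nonneg _) zero_le_one
      _ = d := one_mul d
  rw [hsplit, Matrix.mul_add, nonsing_inv_mul _ hu, trace_add, trace_one]
  gcongr
  calc ((1 + S)⁻¹ * (T - S)).trace = ∑ i, ∑ j, (1 + S)⁻¹ i j * (T - S) j i := by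
        simp only [trace, diag_apply, mul_apply]
    _ ≤ ∑ _i : ι, ∑ _j : ι, d :=
        Finset.sum_le_sum fun i _ => Finset.sum_le_sum fun j _ => hentry i j
    _ = Fintype.card ι ^ 2 * d := by simp; ring

lemma log_det_one_add_le_of_abs_sub_le {S T : Matrix ι ι ℝ} (hS : S.PosSemidef)
    (hT : T.PosSemidef) {d : ℝ} (hd : ∀ i j, |T i j - S i j| ≤ d) :
    Real.log (1 + T).det ≤ Real.log (1 + S).det + Fintype.card ι ^ 2 * d := by
  have htangent := log_det_add_log_det_le (PosDef.one.add_posSemidef hT)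
    (PosDef.one.add_posSemidef hS).inv
  rw [det_nonsing_inv, Ring.inverse_eq_inv', Real.log_inv] at htangent
  linarith [trace_inv_one_add_mul_le hS hd]

section Blocks

variable {α β : Type*}

lemma posDef_fromBlocks_zero [Finite α] [Finite β] {A : Matrix α α ℝ} {D : Matrix β β ℝ}
    (hA : A.PosDef) (hD : D.PosDef) : (fromBlocks A 0 0 D).PosDef := by
  classical
  have := Fintype.ofFinite α
  have := Fintype.ofFinite β
  have : Invertible A := hA.isUnit.invertible
  have hsemi : (fromBlocks A 0 0 D).PosSemidef := by
    simpa using (hA.fromBlocks₁₁ (0 : Matrix α β ℝ) D).2 (by simpa using hD.posSemidef)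
  rw [hsemi.posDef_iff_det_ne_zero, det_fromBlocks_zero₂₁]
  exact mul_ne_zero hA.det_pos.ne' hD.det_pos.ne'

/-- Fischer's inequality. -/
lemma log_det_le_log_det_toBlocks_add [Fintype α] [Fintype β] [DecidableEq α] [DecidableEq β]
    {A : Matrix (α ⊕ β) (α ⊕ β) ℝ} (hA : A.PosDef) :
    Real.log A.det ≤ Real.log A.toBlocks₁₁.det + Real.log A.toBlocks₂₂.det := by
  have h₁ : A.toBlocks₁₁.PosDef := hA.submatrix Sum.inl_injective
  have h₂ : A.toBlocks₂₂.PosDef := hA.submatrix Sum.inr_injective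
  have hu₁ : IsUnit A.toBlocks₁₁.det := isUnit_iff_ne_zero.2 h₁.det_pos.ne'
  have hu₂ : IsUnit A.toBlocks₂₂.det := isUnit_iff_ne_zero.2 h₂.det_pos.ne'
  set M := fromBlocks A.toBlocks₁₁⁻¹ 0 0 A.toBlocks₂₂⁻¹
  have htangent := log_det_add_log_det_le hA (posDef_fromBlocks_zero h₁.inv h₂.inv)
  have htrace : (M * A).trace = Fintype.card (α ⊕ β) := by
    conv_lhs => rw [← fromBlocks_toBlocks A, fromBlocks_multiply]
    simp [trace, nonsing_inv_mul _ hu₁, nonsing_inv_mul _ hu₂]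
  have hlog : Real.log M.det = -Real.log A.toBlocks₁₁.det - Real.log A.toBlocks₂₂.det := by
    rw [det_fromBlocks_zero₂₁, det_nonsing_inv, det_nonsing_inv, Ring.inverse_eq_inv',
      Real.log_mul (inv_ne_zero h₁.det_pos.ne')
      (inv_ne_zero h₂.det_pos.ne'), Real.log_inv, Real.log_inv, sub_eq_add_neg]
  linarith

end Blocks

/-- If `f fᵀ ≤ M (S + φ)` as quadratic forms then `fᵀ (S + φ)⁻¹ f ≤ M`, in eigencoordinates. -/
lemma sum_sq_div_le_of_quadratic_form_le {O : Matrix ι ι ℝ} {l : ι → ℝ} (hO : Oᵀ * O = 1)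
    (hl : ∀ i, 0 ≤ l i) {φ M : ℝ} (hφ : 0 < φ) (hM : 0 ≤ M) (f : ι → ℝ)
    (h : ∀ a : ι → ℝ, (a ⬝ᵥ f) ^ 2 ≤
      M * (a ⬝ᵥ ((O * diagonal l * Oᵀ) *ᵥ a) + φ * (a ⬝ᵥ a))) :
    ∑ i, (Oᵀ *ᵥ f) i ^ 2 / (l i + φ) ≤ M := by
  set c := Oᵀ *ᵥ f
  set b : ι → ℝ := fun i => c i / (l i + φ)
  have hpos : ∀ i, 0 < l i + φ := fun i => add_pos_of_nonneg_of_pos (hl i) hφ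
  set s := ∑ i, c i ^ 2 / (l i + φ)
  have hdot : ∀ v : ι → ℝ, (O *ᵥ b) ⬝ᵥ v = b ⬝ᵥ (Oᵀ *ᵥ v) := fun v => by
    rw [dotProduct_mulVec, vecMul_transpose]
  have hlinear : (O *ᵥ b) ⬝ᵥ f = s := by
    rw [hdot]
    exact Finset.sum_congr rfl fun i _ => by simp only [b, c]; ring
  have hdiag : Oᵀ *ᵥ ((O * diagonal l * Oᵀ) *ᵥ (O *ᵥ b)) = diagonal l *ᵥ b := by
    have hconj : Oᵀ * (O * diagonal l * Oᵀ) * O = (Oᵀ * O) * diagonal l * (Oᵀ * O) := by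
      simp only [Matrix.mul_assoc]
    rw [mulVec_mulVec, mulVec_mulVec, hconj, hO, Matrix.one_mul, Matrix.mul_one]
  have hquadratic : (O *ᵥ b) ⬝ᵥ ((O * diagonal l * Oᵀ) *ᵥ (O *ᵥ b)) +
      φ * ((O *ᵥ b) ⬝ᵥ (O *ᵥ b)) = s := by
    rw [hdot, hdot, hdiag, mulVec_mulVec, hO, one_mulVec]
    simp only [dotProduct, mulVec_diagonal, Finset.mul_sum]
    rw [← Finset.sum_add_distrib]
    refine Finset.sum_congr rfl fun i _ => ?_
    have := (hpos i).ne'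
    simp only [b]
    field_simp
  have hs : s ^ 2 ≤ M * s := by simpa only [hlinear, hquadratic] using h (O *ᵥ b)
  have hs₀ : 0 ≤ s := Finset.sum_nonneg fun i _ => div_nonneg (sq_nonneg (c i)) (hpos i).le
  nlinarith [hs₀]

end LinearAlgebra

section KullbackLeibler

open InformationTheory
open scoped NNReal

variable {α β : Type*} [MeasurableSpace α] [MeasurableSpace β] {ν : Measure α}

lemma withDensity_withDensity_div {f g : α → ℝ≥0∞} (hf : Measurable f) (hg : Measurable g)
    (hgi : ∫⁻ x, g x ∂ν ≠ ∞) (hfg : ∀ᵐ x ∂ν, g x = 0 → f x = 0) :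
    (ν.withDensity g).withDensity (fun x => f x / g x) = ν.withDensity f := by
  rw [← withDensity_mul ν hg (show Measurable fun x => f x / g x from hf.div hg)]
  refine withDensity_congr_ae ?_
  filter_upwards [hfg, ae_lt_top hg hgi] with x hzero htop
  by_cases hx : g x = 0
  · simp [hx, hzero hx]
  · exact ENNReal.mul_div_cancel hx htop.ne

lemma withDensity_absolutelyContinuous_withDensity {f g : α → ℝ≥0∞} (hf : Measurable f)
    (hg : Measurable g) (hgi : ∫⁻ x, g x ∂ν ≠ ∞) (hfg : ∀ᵐ x ∂ν, g x = 0 → f x = 0) :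
    ν.withDensity f ≪ ν.withDensity g := by
  rw [← withDensity_withDensity_div hf hg hgi hfg]
  exact withDensity_absolutelyContinuous _ _

lemma rnDeriv_withDensity_withDensity {f g : α → ℝ≥0∞} (hf : Measurable f) (hg : Measurable g)
    (hgi : ∫⁻ x, g x ∂ν ≠ ∞) (hfg : ∀ᵐ x ∂ν, g x = 0 → f x = 0) :
    (ν.withDensity f).rnDeriv (ν.withDensity g) =ᵐ[ν.withDensity g] fun x => f x / g x := by
  have : IsFiniteMeasure (ν.withDensity g) := isFiniteMeasure_withDensity hgi
  rw [← withDensity_withDensity_div hf hg hgi hfg]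
  exact Measure.rnDeriv_withDensity _ (hf.div hg)

lemma klDiv_withDensity_eq {f g : α → ℝ≥0∞} (hf : Measurable f)
    (hg : Measurable g) (hfi : ∫⁻ x, f x ∂ν ≠ ∞) (hgi : ∫⁻ x, g x ∂ν ≠ ∞)
    (hfg : ∀ᵐ x ∂ν, g x = 0 → f x = 0) :
    klDiv (ν.withDensity f) (ν.withDensity g) =
      ∫⁻ x, g x * ENNReal.ofReal (klFun (f x / g x).toReal) ∂ν := by
  have : IsFiniteMeasure (ν.withDensity g) := isFiniteMeasure_withDensity hgi
  have : IsFiniteMeasure (ν.withDensity f) := isFiniteMeasure_withDensity hfi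
  rw [klDiv_eq_lintegral_klFun_of_ac (withDensity_absolutelyContinuous_withDensity hf hg hgi hfg),
    lintegral_congr_ae ((rnDeriv_withDensity_withDensity hf hg hgi hfg).mono fun x hx => by
      rw [hx]),
    lintegral_withDensity_eq_lintegral_mul _ hg (by fun_prop)]
  rfl

lemma map_snd_prod_withDensity [SFinite ν] {ρ : Measure β} [SFinite ρ] {F : β → α → ℝ≥0∞}
    (hF : Measurable (Function.uncurry F)) :
    ((ρ.prod ν).withDensity (Function.uncurry F)).map Prod.snd =
      ν.withDensity fun x => ∫⁻ r, F r x ∂ρ := by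
  ext s hs
  rw [Measure.map_apply measurable_snd hs, withDensity_apply _ (measurable_snd hs),
    withDensity_apply _ hs, ← Set.univ_prod, setLIntegral_prod_symm _ hF.aemeasurable]
  simp only [Measure.restrict_univ, Function.uncurry_apply_pair]

/-- Joint convexity, as data processing for the projection that forgets the mixing variable. -/
lemma klDiv_withDensity_lintegral_le [SFinite ν] {ρ : Measure β} [SFinite ρ]
    {F G : β → α → ℝ≥0∞} (hF : Measurable (Function.uncurry F))
    (hG : Measurable (Function.uncurry G)) (hFi : ∫⁻ r, ∫⁻ x, F r x ∂ν ∂ρ ≠ ∞)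
    (hGi : ∫⁻ r, ∫⁻ x, G r x ∂ν ∂ρ ≠ ∞) (hFG : ∀ᵐ r ∂ρ, ∀ x, G r x = 0 → F r x = 0) :
    klDiv (ν.withDensity fun x => ∫⁻ r, F r x ∂ρ) (ν.withDensity fun x => ∫⁻ r, G r x ∂ρ) ≤
      ∫⁻ r, klDiv (ν.withDensity (F r)) (ν.withDensity (G r)) ∂ρ := by
  have hFi' : ∫⁻ p, Function.uncurry F p ∂(ρ.prod ν) ≠ ∞ := by
    rwa [lintegral_prod _ hF.aemeasurable]
  have hGi' : ∫⁻ p, Function.uncurry G p ∂(ρ.prod ν) ≠ ∞ := by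
    rwa [lintegral_prod _ hG.aemeasurable]
  have hFG' : ∀ᵐ p ∂(ρ.prod ν), Function.uncurry G p = 0 → Function.uncurry F p = 0 :=
    Measure.quasiMeasurePreserving_fst.ae hFG |>.mono fun p hp => hp p.2
  have : IsFiniteMeasure ((ρ.prod ν).withDensity (Function.uncurry F)) :=
    isFiniteMeasure_withDensity hFi'
  have : IsFiniteMeasure ((ρ.prod ν).withDensity (Function.uncurry G)) :=
    isFiniteMeasure_withDensity hGi'
  have hm : Measurable fun p : β × α => Function.uncurry G p *
      ENNReal.ofReal (klFun (Function.uncurry F p / Function.uncurry G p).toReal) := by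
    fun_prop
  calc klDiv (ν.withDensity fun x => ∫⁻ r, F r x ∂ρ) (ν.withDensity fun x => ∫⁻ r, G r x ∂ρ)
      ≤ klDiv ((ρ.prod ν).withDensity (Function.uncurry F))
          ((ρ.prod ν).withDensity (Function.uncurry G)) := by
        rw [← map_snd_prod_withDensity hF, ← map_snd_prod_withDensity hG]
        exact klDiv_map_le _ _ measurable_snd
    _ = ∫⁻ r, ∫⁻ x, G r x * ENNReal.ofReal (klFun (F r x / G r x).toReal) ∂ν ∂ρ := by
        rw [klDiv_withDensity_eq hF hG hFi' hGi' hFG', lintegral_prod _ hm.aemeasurable]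
        rfl
    _ = ∫⁻ r, klDiv (ν.withDensity (F r)) (ν.withDensity (G r)) ∂ρ := by
        refine lintegral_congr_ae ?_
        filter_upwards [ae_lt_top hF.lintegral_prod_right' hFi,
          ae_lt_top hG.lintegral_prod_right' hGi, hFG] with r hFr hGr hr
        exact (klDiv_withDensity_eq hF.of_uncurry_left hG.of_uncurry_left hFr.ne hGr.ne
          (.of_forall hr)).symm

/-- The excess `g - h` of the reference density is paired with the zero measure. -/
lemma klDiv_withDensity_le_add_of_le [SFinite ν] {f g h : α → ℝ≥0∞} (hf : Measurable f)
    (hg : Measurable g) (hh : Measurable h) (hhg : h ≤ g) (hfi : ∫⁻ x, f x ∂ν ≠ ∞)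
    (hgi : ∫⁻ x, g x ∂ν ≠ ∞) (hfh : ∀ x, h x = 0 → f x = 0) :
    klDiv (ν.withDensity f) (ν.withDensity g) ≤
      klDiv (ν.withDensity f) (ν.withDensity h) + ∫⁻ x, g x ∂ν := by
  set F : Bool → α → ℝ≥0∞ := fun b => cond b f 0
  set G : Bool → α → ℝ≥0∞ := fun b => cond b h (g - h)
  have hF : Measurable (Function.uncurry F) :=
    measurable_from_prod_countable_right (Bool.rec measurable_zero hf)
  have hG : Measurable (Function.uncurry G) :=
    measurable_from_prod_countable_right (Bool.rec (hg.sub hh) hh)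
  have hsum : ∀ u : Bool → ℝ≥0∞, ∫⁻ b, u b ∂Measure.count = u false + u true := fun u => by
    rw [lintegral_count, tsum_bool]
  have hFsum : (fun x => ∫⁻ b, F b x ∂Measure.count) = f := by
    ext x; simp [hsum, F]
  have hGsum : (fun x => ∫⁻ b, G b x ∂Measure.count) = g := by
    ext x; rw [hsum]; exact tsub_add_cancel_of_le (hhg x)
  have hexcess : klDiv (ν.withDensity 0) (ν.withDensity (g - h)) ≤ ∫⁻ x, g x ∂ν := by
    have hsub : ∫⁻ x, (g - h) x ∂ν ≤ ∫⁻ x, g x ∂ν := lintegral_mono fun x => tsub_le_self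
    have := isFiniteMeasure_withDensity (ne_top_of_le_ne_top hgi hsub)
    rw [withDensity_zero, klDiv_zero_left, withDensity_apply _ .univ, Measure.restrict_univ]
    exact hsub
  have hconvex := klDiv_withDensity_lintegral_le (ν := ν) (ρ := .count) hF hG
    (by rwa [lintegral_lintegral_swap hF.aemeasurable, hFsum])
    (by rwa [lintegral_lintegral_swap hG.aemeasurable, hGsum])
    (.of_forall (Bool.rec (fun _ _ => rfl) hfh))
  rw [hFsum, hGsum, hsum] at hconvex
  calc klDiv (ν.withDensity f) (ν.withDensity g)
      ≤ klDiv (ν.withDensity 0) (ν.withDensity (g - h)) +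
          klDiv (ν.withDensity f) (ν.withDensity h) := hconvex
    _ ≤ klDiv (ν.withDensity f) (ν.withDensity h) + ∫⁻ x, g x ∂ν := by
        rw [add_comm]; gcongr

lemma klDiv_smul_right_le {μ ν : Measure α} [IsProbabilityMeasure μ] [IsProbabilityMeasure ν]
    {c : ℝ≥0} (hc : c ≠ 0) (hc₁ : c ≤ 1) :
    klDiv μ (c • ν) ≤ klDiv μ ν + ENNReal.ofReal (-Real.log c) := by
  by_cases htop : klDiv μ ν = ∞
  · simp [htop]
  obtain ⟨hac, hint⟩ := klDiv_ne_top_iff.1 htop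
  have hac' : μ ≪ c • ν := by
    simpa only [Measure.coe_nnreal_smul] using hac.smul_right (ENNReal.coe_ne_zero.2 hc)
  have hne : klDiv μ (c • ν) ≠ ∞ := klDiv_ne_top hac'
    ((integrable_congr (llr_smul_nnreal_right hac c hc)).2 (hint.sub (integrable_const _)))
  have hlog : Real.log c ≤ 0 := Real.log_nonpos c.2 hc₁
  rw [← ENNReal.toReal_le_toReal hne (by finiteness),
    ENNReal.toReal_add htop (by finiteness), toReal_klDiv_smul_right hac hint hc,
    ENNReal.toReal_ofReal (neg_nonneg.2 hlog)]
  have : (c : ℝ) ≤ 1 := hc₁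
  simp only [probReal_univ]
  linarith

lemma klDiv_map_measurableEquiv (e : α ≃ᵐ β) (μ ν : Measure α) [IsFiniteMeasure μ]
    [IsFiniteMeasure ν] : klDiv (μ.map e) (ν.map e) = klDiv μ ν := by
  refine le_antisymm (klDiv_map_le μ ν e.measurable) ?_
  simpa using klDiv_map_le (μ.map e) (ν.map e) e.symm.measurable

lemma klDiv_prod (μ₁ ν₁ : Measure α) (μ₂ ν₂ : Measure β) [IsProbabilityMeasure μ₁]
    [IsProbabilityMeasure ν₁] [IsProbabilityMeasure μ₂] [IsProbabilityMeasure ν₂] :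
    klDiv (μ₁.prod μ₂) (ν₁.prod ν₂) = klDiv μ₁ ν₁ + klDiv μ₂ ν₂ := by
  have hsecond : klDiv (μ₁.prod μ₂) (μ₁.prod ν₂) = klDiv μ₂ ν₂ := by
    have hswap : ⇑(MeasurableEquiv.prodComm : α × β ≃ᵐ β × α) = Prod.swap := rfl
    rw [← klDiv_map_measurableEquiv .prodComm, hswap, Measure.prod_swap,
      Measure.prod_swap, ← Measure.compProd_const, ← Measure.compProd_const,
      klDiv_compProd_left]
  rw [← hsecond, ← Measure.compProd_const, ← Measure.compProd_const, ← Measure.compProd_const,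
    klDiv_compProd_eq_add]

lemma klDiv_pi {n : ℕ} (μ ν : Fin n → Measure α) [∀ i, IsProbabilityMeasure (μ i)]
    [∀ i, IsProbabilityMeasure (ν i)] :
    klDiv (Measure.pi μ) (Measure.pi ν) = ∑ i, klDiv (μ i) (ν i) := by
  induction n with
  | zero => simp [Subsingleton.elim μ ν]
  | succ n ih =>
    have hsplit : ∀ ρ : Fin (n + 1) → Measure α, (∀ i, IsProbabilityMeasure (ρ i)) →
        (Measure.pi ρ).map (MeasurableEquiv.piFinSuccAbove (fun _ => α) 0) =
          (ρ 0).prod (Measure.pi fun i => ρ i.succ) := fun ρ _ =>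
      (measurePreserving_piFinSuccAbove ρ 0).map_eq
    rw [← klDiv_map_measurableEquiv (.piFinSuccAbove (fun _ => α) 0), hsplit μ inferInstance,
      hsplit ν inferInstance, klDiv_prod, ih, Fin.sum_univ_succ]

end KullbackLeibler

section Gaussian

open InformationTheory
open scoped NNReal

lemma lintegral_fin_prod_eq_prod {n : ℕ} {E : Fin n → Type*} [∀ i, MeasurableSpace (E i)]
    {μ : ∀ i, Measure (E i)} [∀ i, SigmaFinite (μ i)] {f : ∀ i, E i → ℝ≥0∞}
    (hf : ∀ i, Measurable (f i)) :
    ∫⁻ x, ∏ i, f i (x i) ∂(Measure.pi μ) = ∏ i, ∫⁻ x, f i x ∂(μ i) := by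
  induction n with
  | zero => simp
  | succ n ih =>
    have htail : Measurable fun y : ∀ i : Fin n, E i.succ => ∏ i, f i.succ (y i) :=
      Finset.measurable_prod _ fun i _ => (hf i.succ).comp (measurable_pi_apply i)
    have hhead : Measurable fun p : E 0 × (∀ i : Fin n, E i.succ) =>
        f 0 p.1 * ∏ i, f i.succ (p.2 i) :=
      ((hf 0).comp measurable_fst).mul (htail.comp measurable_snd)
    calc ∫⁻ x, ∏ i, f i (x i) ∂(Measure.pi μ)
        = ∫⁻ p : E 0 × (∀ i : Fin n, E i.succ), f 0 p.1 * ∏ i, f i.succ (p.2 i)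
            ∂((μ 0).prod (Measure.pi fun i : Fin n => μ i.succ)) := by
          exact (lintegral_congr fun x : ∀ i, E i => Fin.prod_univ_succ fun i => f i (x i)).trans
            ((measurePreserving_piFinSuccAbove μ 0).lintegral_comp hhead)
      _ = ∏ i, ∫⁻ x, f i x ∂(μ i) := by
          rw [lintegral_prod_mul (hf 0).aemeasurable htail.aemeasurable,
            ih fun i => hf i.succ, Fin.prod_univ_succ]

lemma measurable_gaussianPDF_mean (v : ℝ≥0) (x : ℝ) : Measurable fun m => gaussianPDF m v x :=
  measurable_uncurry_gaussianPDF.comp (measurable_id.prodMk (measurable_const (a := (v, x))))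

lemma gaussianPDFReal_mul_gaussianPDFReal {v₁ v₂ : ℝ≥0} (h₁ : v₁ ≠ 0) (h₂ : v₂ ≠ 0) (u w : ℝ) :
    gaussianPDFReal 0 v₂ w * gaussianPDFReal w v₁ u =
      gaussianPDFReal 0 (v₁ + v₂) u *
        gaussianPDFReal (v₂ * u / (v₁ + v₂)) (v₁ * v₂ / (v₁ + v₂)) w := by
  simp only [gaussianPDFReal, NNReal.coe_add, NNReal.coe_div, NNReal.coe_mul]
  rw [mul_mul_mul_comm, mul_mul_mul_comm (√(2 * Real.pi * (v₁ + v₂)))⁻¹, ← Real.exp_add,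
    ← Real.exp_add, ← mul_inv, ← mul_inv, ← Real.sqrt_mul (by positivity),
    ← Real.sqrt_mul (by positivity)]
  congr 1
  · congr 2; field_simp
  · congr 1; field_simp; ring

lemma lintegral_gaussianPDF_gaussianReal {v₁ : ℝ≥0} (h₁ : v₁ ≠ 0) (v₂ : ℝ≥0) (u : ℝ) :
    ∫⁻ w, gaussianPDF w v₁ u ∂(gaussianReal 0 v₂) = gaussianPDF 0 (v₁ + v₂) u := by
  have hm := measurable_gaussianPDF_mean v₁ u
  by_cases h₂ : v₂ = 0
  · rw [h₂, gaussianReal_zero_var, lintegral_dirac' _ hm, add_zero]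
  · have hmul : ∀ w, (gaussianPDF 0 v₂ * fun w => gaussianPDF w v₁ u) w =
        gaussianPDF 0 (v₁ + v₂) u *
          gaussianPDF (v₂ * u / (v₁ + v₂)) (v₁ * v₂ / (v₁ + v₂)) w := fun w => by
      simp only [Pi.mul_apply, gaussianPDF]
      rw [← ENNReal.ofReal_mul (gaussianPDFReal_nonneg _ _ _),
        ← ENNReal.ofReal_mul (gaussianPDFReal_nonneg _ _ _),
        gaussianPDFReal_mul_gaussianPDFReal h₁ h₂]
    rw [gaussianReal_of_var_ne_zero _ h₂,
      lintegral_withDensity_eq_lintegral_mul _ (measurable_gaussianPDF _ _) hm,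
      lintegral_congr hmul, lintegral_const_mul _ (measurable_gaussianPDF _ _),
      lintegral_gaussianPDF_eq_one _ (by positivity), mul_one]

lemma log_gaussianPDFReal (m : ℝ) {v : ℝ≥0} (hv : v ≠ 0) (x : ℝ) :
    Real.log (gaussianPDFReal m v x) =
      -(Real.log (2 * Real.pi * v) / 2) - (x - m) ^ 2 / (2 * v) := by
  rw [gaussianPDFReal, Real.log_mul (by positivity) (Real.exp_pos _).ne', Real.log_exp,
    Real.log_inv, Real.log_sqrt (by positivity)]
  ring

lemma integrable_sub_sq_gaussianReal (c : ℝ) (v : ℝ≥0) (m : ℝ) :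
    Integrable (fun x => (x - m) ^ 2) (gaussianReal c v) :=
  ((memLp_id_gaussianReal 2).sub (memLp_const m)).integrable_sq

lemma integral_sub_sq_gaussianReal (c : ℝ) (v : ℝ≥0) (m : ℝ) :
    ∫ x, (x - m) ^ 2 ∂(gaussianReal c v) = v + (c - m) ^ 2 := by
  have hvar : Var[fun x : ℝ => x - m; gaussianReal c v] = v := by
    rw [variance_sub_const (by fun_prop), variance_fun_id_gaussianReal]
  have hmean : ∫ x, (x - m) ∂(gaussianReal c v) = c - m := by
    rw [integral_sub (f := fun x => x) ((memLp_id_gaussianReal 1).integrable le_rfl)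
      (integrable_const _)]
    simp [integral_id_gaussianReal]
  have h := variance_eq_sub (μ := gaussianReal c v) (X := fun x : ℝ => x - m)
    ((memLp_id_gaussianReal 2).sub (memLp_const m))
  rw [hvar, hmean] at h
  simp only [Pi.pow_apply] at h
  linarith

lemma llr_gaussianReal (m₁ m₂ : ℝ) {v₁ v₂ : ℝ≥0} (h₁ : v₁ ≠ 0) (h₂ : v₂ ≠ 0) :
    llr (gaussianReal m₁ v₁) (gaussianReal m₂ v₂) =ᵐ[gaussianReal m₁ v₁] fun x =>
      Real.log (v₂ / v₁) / 2 + ((x - m₂) ^ 2 / (2 * v₂) - (x - m₁) ^ 2 / (2 * v₁)) := by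
  have hv₁ : (v₁ : ℝ) ≠ 0 := by positivity
  have hv₂ : (v₂ : ℝ) ≠ 0 := by positivity
  have hrn := rnDeriv_withDensity_withDensity (ν := volume) (measurable_gaussianPDF m₁ v₁)
    (measurable_gaussianPDF m₂ v₂) (by simp [lintegral_gaussianPDF_eq_one _ h₂])
    (.of_forall fun x hx => absurd hx (gaussianPDF_pos _ h₂ _).ne')
  rw [← gaussianReal_of_var_ne_zero m₁ h₁, ← gaussianReal_of_var_ne_zero m₂ h₂] at hrn
  have hac : gaussianReal m₁ v₁ ≪ gaussianReal m₂ v₂ :=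
    (gaussianReal_absolutelyContinuous _ h₁).trans (gaussianReal_absolutelyContinuous' _ h₂)
  filter_upwards [hac.ae_le hrn] with x hx
  rw [llr, hx, ENNReal.toReal_div, toReal_gaussianPDF, toReal_gaussianPDF,
    Real.log_div (gaussianPDFReal_pos _ _ _ h₁).ne' (gaussianPDFReal_pos _ _ _ h₂).ne',
    log_gaussianPDFReal _ h₁, log_gaussianPDFReal _ h₂, Real.log_div hv₂ hv₁,
    Real.log_mul (by positivity) hv₁, Real.log_mul (by positivity) hv₂]
  ring

lemma klDiv_gaussianReal (m₁ m₂ : ℝ) {v₁ v₂ : ℝ≥0} (h₁ : v₁ ≠ 0) (h₂ : v₂ ≠ 0) :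
    klDiv (gaussianReal m₁ v₁) (gaussianReal m₂ v₂) =
      ENNReal.ofReal ((Real.log (v₂ / v₁) + (v₁ + (m₁ - m₂) ^ 2) / v₂ - 1) / 2) := by
  have hllr := llr_gaussianReal m₁ m₂ h₁ h₂
  have hsq : ∀ m (v : ℝ≥0), Integrable (fun x : ℝ => (x - m) ^ 2 / (2 * v)) (gaussianReal m₁ v₁) :=
    fun m v => (integrable_sub_sq_gaussianReal m₁ v₁ m).div_const _
  have hdiff : Integrable (fun x => (x - m₂) ^ 2 / (2 * v₂) - (x - m₁) ^ 2 / (2 * v₁))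
    (gaussianReal m₁ v₁) := (hsq m₂ v₂).sub (hsq m₁ v₁)
  have hv₁ : (v₁ : ℝ) ≠ 0 := by positivity
  have hv₂ : (v₂ : ℝ) ≠ 0 := by positivity
  rw [klDiv_of_ac_of_integrable
    ((gaussianReal_absolutelyContinuous _ h₁).trans (gaussianReal_absolutelyContinuous' _ h₂))
    (((integrable_const _).add hdiff).congr hllr.symm), integral_congr_ae hllr,
    integral_add (integrable_const _) hdiff, integral_sub (hsq m₂ v₂) (hsq m₁ v₁)]
  simp only [integral_div, integral_sub_sq_gaussianReal, integral_const, probReal_univ, one_smul,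
    add_sub_cancel_right]
  congr 1
  field_simp
  ring

end Gaussian

section DiagonalGaussian

open InformationTheory

variable {n : ℕ}

/-- The density at `u` of `N(c, diag w)`, for positive variances `w`; it extends
`isoGaussianDensity` to variances that depend on the coordinate. -/
def diagGaussianDensity (c w u : Fin n → ℝ) : ℝ≥0∞ :=
  ∏ i, gaussianPDF (c i) (w i).toNNReal (u i)

@[fun_prop]
lemma measurable_diagGaussianDensity {R : Type*} [MeasurableSpace R] {c w u : R → Fin n → ℝ}
    (hc : Measurable c) (hw : Measurable w) (hu : Measurable u) :
    Measurable fun r => diagGaussianDensity (c r) (w r) (u r) :=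
  Finset.measurable_prod _ fun i _ => measurable_uncurry_gaussianPDF.comp
    (((measurable_pi_apply i).comp hc).prodMk
      (((measurable_pi_apply i).comp hw).real_toNNReal.prodMk ((measurable_pi_apply i).comp hu)))

lemma toNNReal_ne_zero_of_pos {x : ℝ} (hx : 0 < x) : x.toNNReal ≠ 0 :=
  (Real.toNNReal_pos.2 hx).ne'

lemma diagGaussianDensity_ne_zero (c : Fin n → ℝ) {w : Fin n → ℝ} (hw : ∀ i, 0 < w i)
    (u : Fin n → ℝ) : diagGaussianDensity c w u ≠ 0 :=
  Finset.prod_ne_zero_iff.2 fun i _ => (gaussianPDF_pos _ (toNNReal_ne_zero_of_pos (hw i)) _).ne'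

lemma withDensity_diagGaussianDensity (c : Fin n → ℝ) {w : Fin n → ℝ} (hw : ∀ i, 0 < w i) :
    volume.withDensity (diagGaussianDensity c w) =
      Measure.pi fun i => gaussianReal (c i) (w i).toNNReal := by
  refine (Measure.pi_eq fun s hs => ?_).symm
  unfold diagGaussianDensity
  rw [withDensity_apply _ (MeasurableSet.univ_pi hs), volume_pi, Measure.restrict_pi_pi,
    lintegral_fin_prod_eq_prod fun i => measurable_gaussianPDF _ _]
  exact Finset.prod_congr rfl fun i _ =>
    (gaussianReal_apply _ (toNNReal_ne_zero_of_pos (hw i)) _).symm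

lemma isProbabilityMeasure_withDensity_diagGaussianDensity (c : Fin n → ℝ) {w : Fin n → ℝ}
    (hw : ∀ i, 0 < w i) : IsProbabilityMeasure (volume.withDensity (diagGaussianDensity c w)) := by
  rw [withDensity_diagGaussianDensity c hw]
  infer_instance

lemma lintegral_diagGaussianDensity (c : Fin n → ℝ) {w : Fin n → ℝ} (hw : ∀ i, 0 < w i) :
    ∫⁻ u, diagGaussianDensity c w u = 1 := by
  rw [← setLIntegral_univ, ← withDensity_apply _ .univ, withDensity_diagGaussianDensity c hw,
    measure_univ]

lemma klDiv_diagGaussianDensity (c₁ c₂ : Fin n → ℝ) {w₁ w₂ : Fin n → ℝ} (h₁ : ∀ i, 0 < w₁ i)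
    (h₂ : ∀ i, 0 < w₂ i) :
    klDiv (volume.withDensity (diagGaussianDensity c₁ w₁))
        (volume.withDensity (diagGaussianDensity c₂ w₂)) =
      ∑ i, ENNReal.ofReal
        ((Real.log (w₂ i / w₁ i) + (w₁ i + (c₁ i - c₂ i) ^ 2) / w₂ i - 1) / 2) := by
  rw [withDensity_diagGaussianDensity c₁ h₁, withDensity_diagGaussianDensity c₂ h₂, klDiv_pi]
  refine Finset.sum_congr rfl fun i _ => ?_
  rw [klDiv_gaussianReal _ _ (toNNReal_ne_zero_of_pos (h₁ i)) (toNNReal_ne_zero_of_pos (h₂ i)),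
    Real.coe_toNNReal _ (h₁ i).le, Real.coe_toNNReal _ (h₂ i).le]

lemma gaussian_kl_term_le {c l φ ε t s : ℝ} (hl : 0 ≤ l) (hφ : 0 < φ) (hε : 0 < ε) (ht : 0 < t)
    (hts : t ≤ s) (hεs : ε ≤ s) :
    (Real.log (s * (l + φ) / (t * φ)) + (t * φ + c ^ 2) / (s * (l + φ)) - 1) / 2 ≤
      Real.log (s / t) / 2 + Real.log (1 + φ⁻¹ * l) + c ^ 2 / (l + φ) / ε := by
  have hs : 0 < s := ht.trans_le hts
  have hlφ : 0 < l + φ := add_pos_of_nonneg_of_pos hl hφ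
  have hratio : s * (l + φ) / (t * φ) = s / t * (1 + φ⁻¹ * l) := by field_simp; ring
  have hlog : 0 ≤ Real.log (1 + φ⁻¹ * l) :=
    Real.log_nonneg (le_add_of_nonneg_right (mul_nonneg (inv_pos.2 hφ).le hl))
  have hvar : t * φ / (s * (l + φ)) ≤ 1 :=
    (div_le_one (mul_pos hs hlφ)).2
      (mul_le_mul hts (le_add_of_nonneg_left hl) hφ.le hs.le)
  have hmean : c ^ 2 / (s * (l + φ)) ≤ c ^ 2 / (l + φ) / ε := by
    rw [div_div, mul_comm s]
    gcongr
  have hmean₀ : 0 ≤ c ^ 2 / (l + φ) / ε := by positivity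
  rw [hratio, Real.log_mul (by positivity) (by positivity), add_div]
  linarith

lemma klDiv_diagGaussianDensity_le (c : Fin n → ℝ) {l : Fin n → ℝ} (hl : ∀ i, 0 ≤ l i)
    {φ ε t s : ℝ} (hφ : 0 < φ) (hε : 0 < ε) (ht : 0 < t) (hts : t ≤ s) (hεs : ε ≤ s) :
    klDiv (volume.withDensity (diagGaussianDensity c (t • fun _ => φ)))
        (volume.withDensity (diagGaussianDensity 0 (s • fun i => l i + φ))) ≤
      ENNReal.ofReal (n / 2 * Real.log (s / t) + Real.log (∏ i, (1 + φ⁻¹ * l i)) +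
        (∑ i, c i ^ 2 / (l i + φ)) / ε) := by
  have hs : 0 < s := ht.trans_le hts
  have hlφ : ∀ i, 0 < l i + φ := fun i => add_pos_of_nonneg_of_pos (hl i) hφ
  have hone : ∀ i, 1 ≤ 1 + φ⁻¹ * l i := fun i =>
    le_add_of_nonneg_right (mul_nonneg (inv_pos.2 hφ).le (hl i))
  rw [klDiv_diagGaussianDensity _ _ (w₁ := t • fun _ => φ) (w₂ := s • fun i => l i + φ)
    (fun _ => mul_pos ht hφ) fun i => mul_pos hs (hlφ i)]
  calc _ ≤ ∑ i, ENNReal.ofReal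
        (Real.log (s / t) / 2 + Real.log (1 + φ⁻¹ * l i) + c i ^ 2 / (l i + φ) / ε) := by
        gcongr with i
        simpa using gaussian_kl_term_le (c := c i) (hl i) hφ hε ht hts hεs
    _ = _ := by
        rw [← ENNReal.ofReal_sum_of_nonneg fun i _ => ?_]
        · rw [Finset.sum_add_distrib, Finset.sum_add_distrib, Finset.sum_div,
            Real.log_prod fun i _ => (zero_lt_one.trans_le (hone i)).ne', Finset.sum_const,
            Finset.card_univ, Fintype.card_fin, nsmul_eq_mul, mul_div_assoc', div_mul_eq_mul_div]
        · have := hlφ i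
          have := Real.log_nonneg (hone i)
          have := Real.log_nonneg ((one_le_div ht).2 hts)
          positivity

end DiagonalGaussian

section Diagonalization

open Matrix
open scoped NNReal

lemma map_withDensity_of_leftInverse {α β : Type*} [MeasurableSpace α] [MeasurableSpace β]
    {μ : Measure α} {ν : Measure β} {T : α → β} {S : β → α} (hT : MeasurePreserving T μ ν)
    (hS : Measurable S) (hST : Function.LeftInverse S T) {f : α → ℝ≥0∞} (hf : Measurable f) :
    (μ.withDensity f).map T = ν.withDensity (f ∘ S) := by
  ext s hs
  rw [Measure.map_apply hT.measurable hs, withDensity_apply _ hs,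
    withDensity_apply _ (hT.measurable hs), ← hT.setLIntegral_comp_preimage hs (hf.comp hS)]
  simp only [Function.comp_apply, hST _]

variable {n : ℕ} {O : Matrix (Fin n) (Fin n) ℝ}

lemma sum_sq_sub_orthogonal_mulVec (hO : Oᵀ * O = 1) (u a : Fin n → ℝ) :
    ∑ i, ((O *ᵥ u) i - a i) ^ 2 = ∑ i, (u i - (Oᵀ *ᵥ a) i) ^ 2 := by
  have hsub : O *ᵥ u - a = O *ᵥ (u - Oᵀ *ᵥ a) := by
    rw [mulVec_sub, mulVec_mulVec, mul_eq_one_comm.1 hO, one_mulVec]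
  have hdot : ∀ w : Fin n → ℝ, ∑ i, w i ^ 2 = w ⬝ᵥ w := fun w =>
    Finset.sum_congr rfl fun i _ => sq (w i)
  calc ∑ i, ((O *ᵥ u) i - a i) ^ 2 = (O *ᵥ u - a) ⬝ᵥ (O *ᵥ u - a) := hdot (O *ᵥ u - a)
    _ = (u - Oᵀ *ᵥ a) ⬝ᵥ (u - Oᵀ *ᵥ a) := by
        rw [hsub, dotProduct_mulVec, vecMul_mulVec, ← mulVec_transpose, transpose_mul,
          transpose_transpose, hO, one_mulVec]
    _ = _ := (hdot (u - Oᵀ *ᵥ a)).symm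

lemma prod_gaussianPDF_const (c : Fin n → ℝ) (v : ℝ≥0) (u : Fin n → ℝ) :
    ∏ i, gaussianPDF (c i) v (u i) = ENNReal.ofReal
      ((√(2 * Real.pi * v))⁻¹ ^ n * Real.exp (-(∑ i, (u i - c i) ^ 2) / (2 * v))) := by
  simp only [gaussianPDF]
  rw [← ENNReal.ofReal_prod_of_nonneg fun i _ => gaussianPDFReal_nonneg _ _ _]
  simp only [gaussianPDFReal, Finset.prod_mul_distrib, Finset.prod_const, Finset.card_univ,
    Fintype.card_fin, ← Real.exp_sum, neg_div, Finset.sum_neg_distrib, Finset.sum_div]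

lemma isoGaussianDensity_add_orthogonal_mulVec (hO : Oᵀ * O = 1) (m a u : Fin n → ℝ) (v : ℝ) :
    isoGaussianDensity (fun i => m i + a i) v (fun i => m i + (O *ᵥ u) i) =
      diagGaussianDensity (Oᵀ *ᵥ a) (fun _ => v) u := by
  rw [isoGaussianDensity, diagGaussianDensity, prod_gaussianPDF_const, prod_gaussianPDF_const,
    ← sum_sq_sub_orthogonal_mulVec hO]
  simp only [add_sub_add_left_eq_sub]

lemma dotProduct_diagonalization_mulVec (O : Matrix (Fin n) (Fin n) ℝ) (l t : Fin n → ℝ) :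
    t ⬝ᵥ (O * diagonal l * Oᵀ) *ᵥ t = ∑ i, l i * (Oᵀ *ᵥ t) i ^ 2 := by
  rw [← mulVec_mulVec, ← mulVec_mulVec, dotProduct_mulVec, ← mulVec_transpose]
  refine Finset.sum_congr rfl fun i _ => ?_
  rw [mulVec_diagonal]
  ring

lemma posSemidef_diagonalization (O : Matrix (Fin n) (Fin n) ℝ) {l : Fin n → ℝ}
    (hl : ∀ i, 0 ≤ l i) : (O * diagonal l * Oᵀ).PosSemidef := by
  simpa using (PosSemidef.diagonal hl).mul_mul_conjTranspose_same O

lemma multivariateGaussian_eq_map_pi (O : Matrix (Fin n) (Fin n) ℝ) {l : Fin n → ℝ}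
    (hl : ∀ i, 0 ≤ l i) :
    multivariateGaussian 0 (O * diagonal l * Oᵀ) =
      (Measure.pi fun i => gaussianReal 0 (l i).toNNReal).map
        (fun w => WithLp.toLp 2 (O *ᵥ w)) := by
  have hm : Measurable fun w : Fin n → ℝ => WithLp.toLp 2 (O *ᵥ w) := by fun_prop
  have hm₂ : Measurable fun w : Fin n → ℝ => WithLp.toLp 2 w := by fun_prop
  set G := Measure.pi fun i => gaussianReal 0 (l i).toNNReal
  have := Measure.isProbabilityMeasure_map (μ := G) hm.aemeasurable
  refine Measure.ext_of_charFun (funext fun t => ?_)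
  have hadjoint : charFun (G.map fun w => WithLp.toLp 2 (O *ᵥ w)) t =
      charFun (G.map (WithLp.toLp 2)) (WithLp.toLp 2 (Oᵀ *ᵥ t.ofLp)) := by
    rw [charFun_apply, charFun_apply, integral_map hm.aemeasurable (by fun_prop),
      integral_map hm₂.aemeasurable (by fun_prop)]
    refine integral_congr_ae (.of_forall fun w => ?_)
    simp only [EuclideanSpace.inner_eq_star_dotProduct, star_trivial, dotProduct_mulVec,
      ← mulVec_transpose]
  rw [hadjoint, charFun_multivariateGaussian (posSemidef_diagonalization O hl), charFun_pi,
    dotProduct_diagonalization_mulVec]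
  simp_rw [charFun_gaussianReal, Real.coe_toNNReal _ (hl _)]
  rw [← Complex.exp_sum]
  congr 1
  simp [Finset.sum_div]

lemma lintegral_isoGaussianDensity_multivariateGaussian {l : Fin n → ℝ} (hO : Oᵀ * O = 1)
    (hl : ∀ i, 0 ≤ l i) {s φ : ℝ} (hs : 0 < s) (hφ : 0 < φ) (m u : Fin n → ℝ) :
    ∫⁻ τ : EuclideanSpace ℝ (Fin n), isoGaussianDensity (fun i => m i + τ i) (s * φ)
        (fun i => m i + (O *ᵥ u) i) ∂(multivariateGaussian 0 (s • (O * diagonal l * Oᵀ))) =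
      diagGaussianDensity 0 (s • fun i => l i + φ) u := by
  have hscale : s • (O * diagonal l * Oᵀ) = O * diagonal (s • l) * Oᵀ := by
    rw [diagonal_smul, mul_smul_comm, smul_mul_assoc]
  have hsl : ∀ i, 0 ≤ (s • l) i := fun i => mul_nonneg hs.le (hl i)
  have hiso : Measurable fun τ : EuclideanSpace ℝ (Fin n) =>
      isoGaussianDensity (fun i => m i + τ i) (s * φ) (fun i => m i + (O *ᵥ u) i) :=
    measurable_diagGaussianDensity (by fun_prop) measurable_const measurable_const
  rw [hscale, multivariateGaussian_eq_map_pi O hsl, lintegral_map hiso (by fun_prop)]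
  simp only [isoGaussianDensity_add_orthogonal_mulVec hO, mulVec_mulVec, hO, one_mulVec,
    diagGaussianDensity]
  rw [lintegral_fin_prod_eq_prod (f := fun i w => gaussianPDF w (s * φ).toNNReal (u i))
    fun i => measurable_gaussianPDF_mean _ _]
  refine Finset.prod_congr rfl fun i _ => ?_
  rw [lintegral_gaussianPDF_gaussianReal (toNNReal_ne_zero_of_pos (mul_pos hs hφ)),
    ← Real.toNNReal_add (by positivity) (hsl i)]
  simp [mul_add, add_comm]

lemma measurePreserving_add_orthogonal_mulVec (hO : Oᵀ * O = 1) (m : Fin n → ℝ) :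
    MeasurePreserving (fun (u : Fin n → ℝ) i => m i + (O *ᵥ u) i) := by
  have hdet_sq : O.det * O.det = 1 := by
    rw [← det_one (n := Fin n) (R := ℝ), ← hO, det_mul, det_transpose]
  have hdet : |O.det⁻¹| = 1 := by
    rw [abs_inv, inv_eq_one]
    nlinarith [abs_nonneg O.det, abs_mul_abs_self O.det]
  have hrot : MeasurePreserving (toLin' O) := by
    refine ⟨by fun_prop, ?_⟩
    rw [Real.map_matrix_volume_pi_eq_smul_volume_pi (left_ne_zero_of_mul_eq_one hdet_sq), hdet,
      ENNReal.ofReal_one, one_smul]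
  exact (measurePreserving_add_left volume m).comp hrot

end Diagonalization

section ScaleMixture

open InformationTheory
open scoped NNReal

variable {n : ℕ} {H : Measure ℝ} {κ : ℝ → ℝ}

/-- The density at `u` of the scale mixture over `r ∼ H` of the Gaussians `N(c, κ(r) diag w)`. -/
def mixtureDensity (H : Measure ℝ) (κ : ℝ → ℝ) (c w u : Fin n → ℝ) : ℝ≥0∞ :=
  ∫⁻ r, diagGaussianDensity c (κ r • w) u ∂H

lemma measurable_uncurry_diagGaussianDensity {s : ℝ → ℝ} (hs : Measurable s) (c w : Fin n → ℝ) :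
    Measurable (Function.uncurry fun r (u : Fin n → ℝ) => diagGaussianDensity c (s r • w) u) := by
  unfold Function.uncurry
  fun_prop

lemma measurable_mixtureDensity [SFinite H] (hκ : Measurable κ) (c w : Fin n → ℝ) :
    Measurable (mixtureDensity H κ c w) :=
  (measurable_uncurry_diagGaussianDensity hκ c w).lintegral_prod_left'

lemma lintegral_lintegral_diagGaussianDensity [IsProbabilityMeasure H]
    (hκ₀ : ∀ᵐ r ∂H, 0 < κ r) (c : Fin n → ℝ) {w : Fin n → ℝ} (hw : ∀ i, 0 < w i) :
    ∫⁻ r, (∫⁻ u, diagGaussianDensity c (κ r • w) u) ∂H = 1 := by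
  rw [lintegral_congr_ae (g := fun _ => 1) (hκ₀.mono fun r hr =>
    lintegral_diagGaussianDensity c (w := κ r • w) fun i => mul_pos hr (hw i)),
    lintegral_one, measure_univ]

lemma lintegral_mixtureDensity [IsProbabilityMeasure H] (hκ : Measurable κ)
    (hκ₀ : ∀ᵐ r ∂H, 0 < κ r) (c : Fin n → ℝ) {w : Fin n → ℝ} (hw : ∀ i, 0 < w i) :
    ∫⁻ u, mixtureDensity H κ c w u = 1 := by
  rw [← lintegral_lintegral_diagGaussianDensity hκ₀ c hw, lintegral_lintegral_swap
    (measurable_uncurry_diagGaussianDensity hκ c w).aemeasurable]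
  rfl

/-- The scale of the model component that stands in for the one of scale `t`: components of scale
below `ε`, whose divergence is uncontrolled, are replaced by the one of scale `a`. -/
def surrogateScale (ε a t : ℝ) : ℝ :=
  if t < ε then a else t

/-- The weight of the surrogate component: half of the model density is kept, and the other half
dominates `2⁻¹ * ρ` times the component of scale `a`. -/
def surrogateWeight (ε : ℝ) (ρ : ℝ≥0) (t : ℝ) : ℝ≥0 :=
  if t < ε then 2⁻¹ * ρ else 2⁻¹

variable {ε a : ℝ} {ρ : ℝ≥0}

@[fun_prop]
lemma measurable_surrogateScale : Measurable (surrogateScale ε a) :=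
  Measurable.ite measurableSet_Iio measurable_const measurable_id

@[fun_prop]
lemma measurable_surrogateWeight : Measurable (surrogateWeight ε ρ) :=
  Measurable.ite measurableSet_Iio measurable_const measurable_const

lemma le_surrogateScale (hεa : ε ≤ a) (t : ℝ) : ε ≤ surrogateScale ε a t := by
  unfold surrogateScale
  split_ifs with h
  · exact hεa
  · exact not_lt.1 h

lemma self_le_surrogateScale (hεa : ε ≤ a) (t : ℝ) : t ≤ surrogateScale ε a t := by
  unfold surrogateScale
  split_ifs with h
  · exact h.le.trans hεa
  · exact le_rfl

lemma surrogateWeight_ne_zero (hρ : ρ ≠ 0) (t : ℝ) : surrogateWeight ε ρ t ≠ 0 := by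
  unfold surrogateWeight
  split_ifs <;> simp [hρ]

lemma surrogateWeight_le_one (hρ : ρ ≤ 1) (t : ℝ) : surrogateWeight ε ρ t ≤ 1 := by
  have hhalf : (2⁻¹ : ℝ≥0) ≤ 1 := by norm_num
  unfold surrogateWeight
  split_ifs
  · exact mul_le_one' hhalf hρ
  · exact hhalf

/-- The weighted centred Gaussian with variances proportional to `w` that the model component of
scale `t` is replaced by. -/
def surrogateComponent (ε a : ℝ) (ρ : ℝ≥0) (w : Fin n → ℝ) (t : ℝ) (u : Fin n → ℝ) : ℝ≥0∞ :=
  surrogateWeight ε ρ t * diagGaussianDensity 0 (surrogateScale ε a t • w) u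

lemma measurable_uncurry_surrogateComponent (hκ : Measurable κ) (w : Fin n → ℝ) :
    Measurable (Function.uncurry fun r => surrogateComponent ε a ρ w (κ r)) := by
  unfold Function.uncurry surrogateComponent
  fun_prop

lemma surrogateComponent_ne_zero (hε : 0 < ε) (hεa : ε ≤ a) (hρ : ρ ≠ 0) {w : Fin n → ℝ}
    (hw : ∀ i, 0 < w i) (t : ℝ) (u : Fin n → ℝ) : surrogateComponent ε a ρ w t u ≠ 0 :=
  mul_ne_zero (ENNReal.coe_ne_zero.2 (surrogateWeight_ne_zero hρ t))
    (diagGaussianDensity_ne_zero _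
      (fun i => mul_pos (hε.trans_le (le_surrogateScale hεa t)) (hw i)) _)

lemma lintegral_surrogateComponent_le [IsProbabilityMeasure H] {w u : Fin n → ℝ}
    (hdom : ρ * diagGaussianDensity 0 (a • w) u ≤ mixtureDensity H κ 0 w u) :
    ∫⁻ r, surrogateComponent ε a ρ w (κ r) u ∂H ≤ mixtureDensity H κ 0 w u := by
  set f : ℝ → ℝ≥0∞ := fun t => diagGaussianDensity 0 (t • w) u
  have hhalf : ((2⁻¹ : ℝ≥0) : ℝ≥0∞) = 2⁻¹ := by simp
  calc ∫⁻ r, surrogateComponent ε a ρ w (κ r) u ∂H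
      ≤ ∫⁻ r, (2⁻¹ * (ρ * f a) + 2⁻¹ * f (κ r)) ∂H := by
        gcongr with r
        unfold surrogateComponent surrogateWeight surrogateScale
        split_ifs
        · rw [ENNReal.coe_mul, hhalf, mul_assoc]
          exact le_self_add
        · rw [hhalf]
          exact le_add_self
    _ = 2⁻¹ * (ρ * f a) + 2⁻¹ * mixtureDensity H κ 0 w u := by
        rw [lintegral_add_left measurable_const, lintegral_const, measure_univ, mul_one,
          lintegral_const_mul' _ _ (by simp)]
        rfl
    _ ≤ 2⁻¹ * mixtureDensity H κ 0 w u + 2⁻¹ * mixtureDensity H κ 0 w u := by gcongr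
    _ = mixtureDensity H κ 0 w u := by rw [← add_mul, ENNReal.inv_two_add_inv_two, one_mul]

lemma surrogate_cost_eq (k : ℝ) {t : ℝ} (ha : 0 < a) (hρ : ρ ≠ 0) (ht : 0 < t) :
    k * Real.log (surrogateScale ε a t / t) - Real.log (surrogateWeight ε ρ t) =
      Real.log 2 + (Set.Iio ε).indicator
        (fun t => k * (Real.log a - Real.log t) - Real.log ρ) t := by
  have hρ' : (ρ : ℝ) ≠ 0 := NNReal.coe_ne_zero.2 hρ
  by_cases h : t < ε
  · rw [Set.indicator_of_mem (Set.mem_Iio.2 h), surrogateScale, surrogateWeight, if_pos h,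
      if_pos h, Real.log_div ha.ne' ht.ne', NNReal.coe_mul, NNReal.coe_inv, NNReal.coe_ofNat,
      Real.log_mul (by norm_num) hρ', Real.log_inv]
    ring
  · rw [Set.indicator_of_notMem (by simpa using h), surrogateScale, surrogateWeight, if_neg h,
      if_neg h, div_self ht.ne', Real.log_one, NNReal.coe_inv, NNReal.coe_ofNat, Real.log_inv]
    ring

lemma klDiv_surrogateComponent_le (c : Fin n → ℝ) {l : Fin n → ℝ} (hl : ∀ i, 0 ≤ l i) {φ t : ℝ}
    (hφ : 0 < φ) (hε : 0 < ε) (hεa : ε ≤ a) (hρ : ρ ≠ 0) (hρ₁ : ρ ≤ 1) (ht : 0 < t) :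
    klDiv (volume.withDensity (diagGaussianDensity c (t • fun _ => φ)))
        (volume.withDensity (surrogateComponent ε a ρ (fun i => l i + φ) t)) ≤
      ENNReal.ofReal (Real.log (∏ i, (1 + φ⁻¹ * l i))) +
        ENNReal.ofReal ((∑ i, c i ^ 2 / (l i + φ)) / ε) + ENNReal.ofReal (Real.log 2) +
        ENNReal.ofReal ((Set.Iio ε).indicator
          (fun t => n / 2 * (Real.log a - Real.log t) - Real.log ρ) t) := by
  set s := surrogateScale ε a t
  set θ := surrogateWeight ε ρ t
  set N := diagGaussianDensity 0 (s • fun i => l i + φ)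
  set L := Real.log (∏ i, (1 + φ⁻¹ * l i))
  set Q := (∑ i, c i ^ 2 / (l i + φ)) / ε
  have hts : t ≤ s := self_le_surrogateScale hεa t
  have hεs : ε ≤ s := le_surrogateScale hεa t
  have hθ₁ : θ ≤ 1 := surrogateWeight_le_one hρ₁ t
  have := isProbabilityMeasure_withDensity_diagGaussianDensity c (w := t • fun _ => φ)
    fun _ => mul_pos ht hφ
  have : IsProbabilityMeasure (volume.withDensity N) :=
    isProbabilityMeasure_withDensity_diagGaussianDensity 0
      fun i => mul_pos (ht.trans_le hts) (add_pos_of_nonneg_of_pos (hl i) hφ)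
  have hsmul : volume.withDensity (surrogateComponent ε a ρ (fun i => l i + φ) t) =
      θ • volume.withDensity N :=
    withDensity_smul _ (by fun_prop)
  have hscale : 0 ≤ n / 2 * Real.log (s / t) :=
    mul_nonneg (by positivity) (Real.log_nonneg ((one_le_div ht).2 hts))
  have hweight : 0 ≤ -Real.log θ := neg_nonneg.2 (Real.log_nonpos θ.2 hθ₁)
  rw [hsmul]
  calc klDiv (volume.withDensity (diagGaussianDensity c (t • fun _ => φ)))
        (θ • volume.withDensity N)
      ≤ ENNReal.ofReal (n / 2 * Real.log (s / t) + L + Q) + ENNReal.ofReal (-Real.log θ) :=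
        (klDiv_smul_right_le (surrogateWeight_ne_zero hρ t) hθ₁).trans <| by
          gcongr
          exact klDiv_diagGaussianDensity_le c hl hφ hε ht hts hεs
    _ ≤ ENNReal.ofReal (n / 2 * Real.log (s / t)) + ENNReal.ofReal L + ENNReal.ofReal Q +
          ENNReal.ofReal (-Real.log θ) := by
        gcongr
        exact ENNReal.ofReal_add_le.trans (by gcongr; exact ENNReal.ofReal_add_le)
    _ = ENNReal.ofReal L + ENNReal.ofReal Q +
          ENNReal.ofReal (n / 2 * Real.log (s / t) - Real.log θ) := by
        rw [sub_eq_add_neg, ENNReal.ofReal_add hscale hweight]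
        ring
    _ ≤ _ := by
        rw [surrogate_cost_eq _ (hε.trans_le hεa) hρ ht, add_assoc _ (ENNReal.ofReal (Real.log 2))]
        gcongr
        exact ENNReal.ofReal_add_le

lemma klDiv_mixtureDensity_le_lintegral [IsProbabilityMeasure H] (hκ : Measurable κ)
    (hκ₀ : ∀ᵐ r ∂H, 0 < κ r) (c : Fin n → ℝ) {v w : Fin n → ℝ} (hv : ∀ i, 0 < v i)
    (hw : ∀ i, 0 < w i) (hε : 0 < ε) (hεa : ε ≤ a) (hρ : ρ ≠ 0)
    (hdom : ∀ u, ρ * diagGaussianDensity 0 (a • w) u ≤ mixtureDensity H κ 0 w u) :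
    klDiv (volume.withDensity (mixtureDensity H κ c v))
        (volume.withDensity (mixtureDensity H κ 0 w)) ≤
      ∫⁻ r, klDiv (volume.withDensity (diagGaussianDensity c (κ r • v)))
        (volume.withDensity (surrogateComponent ε a ρ w (κ r))) ∂H + 1 := by
  set G : ℝ → (Fin n → ℝ) → ℝ≥0∞ := fun r => surrogateComponent ε a ρ w (κ r)
  have hF := measurable_uncurry_diagGaussianDensity hκ c v
  have hG : Measurable (Function.uncurry G) := measurable_uncurry_surrogateComponent hκ w
  have hGmix : (fun u => ∫⁻ r, G r u ∂H) ≤ mixtureDensity H κ 0 w := fun u =>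
    lintegral_surrogateComponent_le (hdom u)
  have hmix := lintegral_mixtureDensity hκ hκ₀ 0 hw
  have hFi := lintegral_lintegral_diagGaussianDensity hκ₀ c hv
  have hGi : ∫⁻ r, (∫⁻ u, G r u) ∂H ≤ 1 := by
    rw [lintegral_lintegral_swap hG.aemeasurable, ← hmix]
    exact lintegral_mono hGmix
  have hG₀ : ∀ r u, G r u ≠ 0 := fun r u => surrogateComponent_ne_zero hε hεa hρ hw _ _
  have hGint₀ : ∀ u, ∫⁻ r, G r u ∂H ≠ 0 := fun u h => by
    obtain ⟨r, hr⟩ := ((lintegral_eq_zero_iff hG.of_uncurry_right).1 h).exists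
    exact hG₀ r u hr
  calc klDiv (volume.withDensity (mixtureDensity H κ c v))
        (volume.withDensity (mixtureDensity H κ 0 w))
      ≤ klDiv (volume.withDensity (mixtureDensity H κ c v))
          (volume.withDensity fun u => ∫⁻ r, G r u ∂H) + ∫⁻ u, mixtureDensity H κ 0 w u :=
        klDiv_withDensity_le_add_of_le (measurable_mixtureDensity hκ _ _)
          (measurable_mixtureDensity hκ _ _) hG.lintegral_prod_left' hGmix
          (by simp [lintegral_mixtureDensity hκ hκ₀ c hv]) (by simp [hmix])
          fun u h => absurd h (hGint₀ u)
    _ ≤ _ := by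
        rw [hmix]
        gcongr
        exact klDiv_withDensity_lintegral_le hF hG (hFi.trans_ne ENNReal.one_ne_top)
          (ne_top_of_le_ne_top ENNReal.one_ne_top hGi)
          (.of_forall fun r u h => absurd h (hG₀ r u))

lemma klDiv_mixtureDensity_le_of_mul_le [IsProbabilityMeasure H] (hκ : Measurable κ)
    (hκ₀ : ∀ᵐ r ∂H, 0 < κ r) {φ : ℝ} (hφ : 0 < φ) (c : Fin n → ℝ) {l : Fin n → ℝ}
    (hl : ∀ i, 0 ≤ l i) (hε : 0 < ε) (hεa : ε ≤ a) (hρ : ρ ≠ 0) (hρ₁ : ρ ≤ 1)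
    (hdom : ∀ u, ρ * diagGaussianDensity 0 (a • fun i => l i + φ) u ≤
      mixtureDensity H κ 0 (fun i => l i + φ) u) :
    klDiv (volume.withDensity (mixtureDensity H κ c fun _ => φ))
        (volume.withDensity (mixtureDensity H κ 0 fun i => l i + φ)) ≤
      ENNReal.ofReal (Real.log (∏ i, (1 + φ⁻¹ * l i))) +
        ENNReal.ofReal ((∑ i, c i ^ 2 / (l i + φ)) / ε) + ENNReal.ofReal (Real.log 2) +
        ∫⁻ r in {r | κ r < ε},
          ENNReal.ofReal (n / 2 * (Real.log a - Real.log (κ r)) - Real.log ρ) ∂H + 1 := by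
  have hE : MeasurableSet {r | κ r < ε} := measurableSet_lt hκ measurable_const
  refine (klDiv_mixtureDensity_le_lintegral hκ hκ₀ c (fun _ => hφ)
    (fun i => add_pos_of_nonneg_of_pos (hl i) hφ) hε hεa hρ hdom).trans ?_
  gcongr ?_ + 1
  calc _ ≤ ∫⁻ r, (ENNReal.ofReal (Real.log (∏ i, (1 + φ⁻¹ * l i))) +
          ENNReal.ofReal ((∑ i, c i ^ 2 / (l i + φ)) / ε) + ENNReal.ofReal (Real.log 2) +
          {r | κ r < ε}.indicator (fun r =>
            ENNReal.ofReal (n / 2 * (Real.log a - Real.log (κ r)) - Real.log ρ)) r) ∂H := by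
        refine lintegral_mono_ae (hκ₀.mono fun r hr => ?_)
        refine (klDiv_surrogateComponent_le c hl hφ hε hεa hρ hρ₁ hr).trans_eq ?_
        simp only [Set.indicator, Set.mem_Iio, Set.mem_ofPred_eq, apply_ite ENNReal.ofReal,
          ENNReal.ofReal_zero]
    _ = _ := by
        rw [lintegral_add_left measurable_const, lintegral_const, measure_univ, mul_one,
          lintegral_indicator hE]

end ScaleMixture

section ScaleWindow

open InformationTheory
open scoped NNReal

variable {n : ℕ} {H : Measure ℝ} {κ : ℝ → ℝ} {a b : ℝ} {w : Fin n → ℝ}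

lemma sqrt_mul_gaussianPDFReal_le {s v : ℝ} (ha : 0 < a) (has : a ≤ s) (hsb : s ≤ b)
    (hv : 0 < v) (x : ℝ) :
    √(a / b) * gaussianPDFReal 0 (a * v).toNNReal x ≤ gaussianPDFReal 0 (s * v).toNNReal x := by
  have hs := ha.trans_le has
  have hb := hs.trans_le hsb
  have hconst : √(a / b) * (√(2 * Real.pi * (a * v)))⁻¹ = (√(2 * Real.pi * (b * v)))⁻¹ := by
    rw [← Real.sqrt_inv, ← Real.sqrt_inv, ← Real.sqrt_mul (by positivity)]
    congr 1
    field_simp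
  simp only [gaussianPDFReal, Real.coe_toNNReal _ (mul_pos ha hv).le,
    Real.coe_toNNReal _ (mul_pos hs hv).le, sub_zero, neg_div]
  rw [← mul_assoc, hconst]
  gcongr

lemma sqrt_pow_mul_diagGaussianDensity_le {s : ℝ} (ha : 0 < a) (has : a ≤ s) (hsb : s ≤ b)
    (hw : ∀ i, 0 < w i) (u : Fin n → ℝ) :
    ENNReal.ofReal √(a / b) ^ n * diagGaussianDensity 0 (a • w) u ≤
      diagGaussianDensity 0 (s • w) u := by
  calc ENNReal.ofReal √(a / b) ^ n * diagGaussianDensity 0 (a • w) u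
      = ∏ i, ENNReal.ofReal √(a / b) * gaussianPDF 0 (a * w i).toNNReal (u i) := by
        rw [Finset.prod_mul_distrib, Finset.prod_const, Finset.card_univ, Fintype.card_fin]
        rfl
    _ ≤ ∏ i, gaussianPDF 0 (s * w i).toNNReal (u i) := by
        gcongr with i
        rw [gaussianPDF, gaussianPDF, ← ENNReal.ofReal_mul (Real.sqrt_nonneg _)]
        exact ENNReal.ofReal_le_ofReal (sqrt_mul_gaussianPDFReal_le ha has hsb (hw i) _)

lemma measure_mul_diagGaussianDensity_le_mixtureDensity (hκ : Measurable κ) (ha : 0 < a)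
    (hw : ∀ i, 0 < w i) (u : Fin n → ℝ) :
    H (κ ⁻¹' Set.Icc a b) * ENNReal.ofReal √(a / b) ^ n * diagGaussianDensity 0 (a • w) u ≤
      mixtureDensity H κ 0 w u := by
  calc H (κ ⁻¹' Set.Icc a b) * ENNReal.ofReal √(a / b) ^ n * diagGaussianDensity 0 (a • w) u
      = ∫⁻ _ in κ ⁻¹' Set.Icc a b,
          ENNReal.ofReal √(a / b) ^ n * diagGaussianDensity 0 (a • w) u ∂H := by
        rw [setLIntegral_const, mul_assoc, mul_comm]
    _ ≤ ∫⁻ r in κ ⁻¹' Set.Icc a b, diagGaussianDensity 0 (κ r • w) u ∂H :=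
        setLIntegral_mono' (hκ measurableSet_Icc) fun r hr =>
          sqrt_pow_mul_diagGaussianDensity_le ha hr.1 hr.2 hw u
    _ ≤ mixtureDensity H κ 0 w u := setLIntegral_le_lintegral _ _

lemma log_mul_sqrt_div_pow {x : ℝ} (hx : x ≠ 0) (ha : 0 < a) (hb : 0 < b) (n : ℕ) :
    Real.log (x * √(a / b) ^ n) = Real.log x + n / 2 * (Real.log a - Real.log b) := by
  have hab : 0 < a / b := div_pos ha hb
  rw [Real.log_mul hx (by positivity), Real.log_pow, Real.log_sqrt hab.le,
    Real.log_div ha.ne' hb.ne']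
  ring

lemma ofReal_half_mul_add_le {x y : ℝ} (hx : 0 ≤ x) (n : ℕ) :
    ENNReal.ofReal (n / 2 * x + y) ≤ n * ENNReal.ofReal x + ENNReal.ofReal y := by
  refine ENNReal.ofReal_add_le.trans ?_
  gcongr
  rw [← ENNReal.ofReal_natCast n, ← ENNReal.ofReal_mul (Nat.cast_nonneg n)]
  exact ENNReal.ofReal_le_ofReal
    (mul_le_mul_of_nonneg_right (half_le_self (Nat.cast_nonneg n)) hx)

lemma setLIntegral_surrogate_cost_le [IsProbabilityMeasure H] (hκ : Measurable κ)
    (hκ₀ : ∀ᵐ r ∂H, 0 < κ r) {ε x : ℝ} (hε : 0 < ε) (hεa : ε ≤ a) (hab : a ≤ b) (hx : x ≠ 0)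
    (n : ℕ) :
    ∫⁻ r in {r | κ r < ε}, ENNReal.ofReal
        (n / 2 * (Real.log a - Real.log (κ r)) - Real.log (x * √(a / b) ^ n)) ∂H ≤
      n * ∫⁻ r in {r | κ r < ε}, ENNReal.ofReal (Real.log b - Real.log (κ r)) ∂H +
        ENNReal.ofReal (-Real.log x) := by
  have ha := hε.trans_le hεa
  have hE : MeasurableSet {r | κ r < ε} := measurableSet_lt hκ measurable_const
  calc _ ≤ ∫⁻ r in {r | κ r < ε}, (n * ENNReal.ofReal (Real.log b - Real.log (κ r)) +
          ENNReal.ofReal (-Real.log x)) ∂H := by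
        refine setLIntegral_mono_ae' hE (hκ₀.mono fun r hr hrε => ?_)
        have hlog : 0 ≤ Real.log b - Real.log (κ r) :=
          sub_nonneg.2 (Real.log_le_log hr (hrε.le.trans (hεa.trans hab)))
        refine le_of_eq_of_le ?_ (ofReal_half_mul_add_le hlog n)
        rw [log_mul_sqrt_div_pow hx ha (ha.trans_le hab)]
        ring_nf
    _ = n * ∫⁻ r in {r | κ r < ε}, ENNReal.ofReal (Real.log b - Real.log (κ r)) ∂H +
          ENNReal.ofReal (-Real.log x) * H {r | κ r < ε} := by
        rw [lintegral_add_right _ measurable_const, lintegral_const_mul' _ _ (by simp),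
          setLIntegral_const]
    _ ≤ _ := by
        gcongr
        exact mul_le_of_le_one_right' prob_le_one

lemma klDiv_mixtureDensity_le [IsProbabilityMeasure H] (hκ : Measurable κ)
    (hκ₀ : ∀ᵐ r ∂H, 0 < κ r) {φ : ℝ} (hφ : 0 < φ) (c : Fin n → ℝ) {l : Fin n → ℝ}
    (hl : ∀ i, 0 ≤ l i) {ε : ℝ} (hε : 0 < ε) (hεa : ε ≤ a) (hab : a ≤ b)
    (hH : H (κ ⁻¹' Set.Icc a b) ≠ 0) :
    klDiv (volume.withDensity (mixtureDensity H κ c fun _ => φ))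
        (volume.withDensity (mixtureDensity H κ 0 fun i => l i + φ)) ≤
      ENNReal.ofReal (Real.log (∏ i, (1 + φ⁻¹ * l i))) +
        ENNReal.ofReal ((∑ i, c i ^ 2 / (l i + φ)) / ε) + ENNReal.ofReal (Real.log 2) +
        (n * ∫⁻ r in {r | κ r < ε}, ENNReal.ofReal (Real.log b - Real.log (κ r)) ∂H +
          ENNReal.ofReal (-Real.log (H.real (κ ⁻¹' Set.Icc a b)))) + 1 := by
  have ha := hε.trans_le hεa
  have hb := ha.trans_le hab
  have hratio : √(a / b) ≤ 1 := Real.sqrt_le_one.2 ((div_le_one hb).2 hab)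
  have hH' : H.real (κ ⁻¹' Set.Icc a b) ≠ 0 :=
    ENNReal.toReal_ne_zero.2 ⟨hH, measure_ne_top _ _⟩
  set ρ : ℝ≥0 := (H (κ ⁻¹' Set.Icc a b)).toNNReal * (√(a / b)).toNNReal ^ n
  have hρ_coe : (ρ : ℝ≥0∞) = H (κ ⁻¹' Set.Icc a b) * ENNReal.ofReal √(a / b) ^ n := by
    rw [ENNReal.coe_mul, ENNReal.coe_toNNReal (measure_ne_top _ _), ENNReal.coe_pow]
    rfl
  have hρ_real : (ρ : ℝ) = H.real (κ ⁻¹' Set.Icc a b) * √(a / b) ^ n := by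
    rw [NNReal.coe_mul, NNReal.coe_pow, Real.coe_toNNReal _ (Real.sqrt_nonneg _)]
    rfl
  have hρ : ρ ≠ 0 := by
    rw [← NNReal.coe_ne_zero, hρ_real]
    exact mul_ne_zero hH' (pow_pos (Real.sqrt_pos.2 (div_pos ha hb)) n).ne'
  have hρ₁ : ρ ≤ 1 := by
    rw [← NNReal.coe_le_one, hρ_real]
    exact mul_le_one₀ measureReal_le_one (by positivity) (pow_le_one₀ (Real.sqrt_nonneg _) hratio)
  refine (klDiv_mixtureDensity_le_of_mul_le hκ hκ₀ hφ c hl hε hεa hρ hρ₁ fun u => ?_).trans ?_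
  · rw [hρ_coe]
    exact measure_mul_diagGaussianDensity_le_mixtureDensity hκ ha
      (fun i => add_pos_of_nonneg_of_pos (hl i) hφ) u
  · rw [hρ_real]
    gcongr
    exact setLIntegral_surrogate_cost_le hκ hκ₀ hε hεa hab hH' n

end ScaleWindow

section PointwiseBound

open InformationTheory Matrix

variable {𝒳 : Type} {H : Measure ℝ} {κ : ℝ → ℝ} {φ : ℝ} {K C : 𝒳 → 𝒳 → ℝ} {τ₀ : 𝒳 → ℝ} {B δ : ℝ}
  {n : ℕ} (X : Fin n → 𝒳)

lemma trueDensity_add_orthogonal_mulVec (m u : Fin n → ℝ) {O : Matrix (Fin n) (Fin n) ℝ}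
    (hO : Oᵀ * O = 1) :
    trueDensity H κ φ τ₀ m X (fun i => m i + (O *ᵥ u) i) =
      mixtureDensity H κ (Oᵀ *ᵥ fun i => τ₀ (X i)) (fun _ => φ) u :=
  lintegral_congr fun r =>
    isoGaussianDensity_add_orthogonal_mulVec hO m (fun i => τ₀ (X i)) u (κ r * φ)

lemma modelDensity_add_orthogonal_mulVec (hκ₀ : ∀ᵐ r ∂H, 0 < κ r) (hφ : 0 < φ)
    (m u : Fin n → ℝ) {O : Matrix (Fin n) (Fin n) ℝ} {l : Fin n → ℝ} (hO : Oᵀ * O = 1)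
    (hl : ∀ i, 0 ≤ l i) (hgram : gram K X = O * diagonal l * Oᵀ) :
    modelDensity H κ φ K m X (fun i => m i + (O *ᵥ u) i) =
      mixtureDensity H κ 0 (fun i => l i + φ) u := by
  rw [modelDensity, hgram]
  exact lintegral_congr_ae (hκ₀.mono fun r hr =>
    lintegral_isoGaussianDensity_multivariateGaussian hO hl hr hφ m u)

lemma klDensity_le_klDiv_mixtureDensity [IsProbabilityMeasure H] (hκ : Measurable κ)
    (hκ₀ : ∀ᵐ r ∂H, 0 < κ r) (hφ : 0 < φ) (m : Fin n → ℝ) {O : Matrix (Fin n) (Fin n) ℝ}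
    {l : Fin n → ℝ} (hO : Oᵀ * O = 1) (hl : ∀ i, 0 ≤ l i)
    (hgram : gram K X = O * diagonal l * Oᵀ) :
    klDensity (trueDensity H κ φ τ₀ m X) (modelDensity H κ φ K m X) ≤
      klDiv (volume.withDensity (mixtureDensity H κ (Oᵀ *ᵥ fun i => τ₀ (X i)) fun _ => φ))
        (volume.withDensity (mixtureDensity H κ 0 fun i => l i + φ)) := by
  set T : (Fin n → ℝ) → Fin n → ℝ := fun u i => m i + (O *ᵥ u) i
  set S : (Fin n → ℝ) → Fin n → ℝ := fun y => Oᵀ *ᵥ (y - m)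
  have hST : Function.LeftInverse S T := fun u => by
    have hsub : T u - m = O *ᵥ u := add_sub_cancel_left m _
    simp only [S, hsub, mulVec_mulVec, hO, one_mulVec]
  have hTS : Function.RightInverse S T := fun y => by
    ext i
    simp [T, S, mulVec_mulVec, mul_eq_one_comm.1 hO]
  have hT : MeasurePreserving T := measurePreserving_add_orthogonal_mulVec hO m
  have hS : Measurable S := by fun_prop
  have htrue : trueDensity H κ φ τ₀ m X =
      mixtureDensity H κ (Oᵀ *ᵥ fun i => τ₀ (X i)) (fun _ => φ) ∘ S := by
    ext y
    rw [Function.comp_apply, ← trueDensity_add_orthogonal_mulVec X m (S y) hO]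
    exact congrArg _ (hTS y).symm
  have hmodel : modelDensity H κ φ K m X = mixtureDensity H κ 0 (fun i => l i + φ) ∘ S := by
    ext y
    rw [Function.comp_apply, ← modelDensity_add_orthogonal_mulVec X hκ₀ hφ m (S y) hO hl hgram]
    exact congrArg _ (hTS y).symm
  have hweight : ∀ i, 0 < l i + φ := fun i => add_pos_of_nonneg_of_pos (hl i) hφ
  have hfin : ∀ c w : Fin n → ℝ, (∀ i, 0 < w i) →
      IsFiniteMeasure (volume.withDensity (mixtureDensity H κ c w)) := fun c w hw =>
    isFiniteMeasure_withDensity (by simp [lintegral_mixtureDensity hκ hκ₀ c hw])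
  have := hfin (Oᵀ *ᵥ fun i => τ₀ (X i)) (fun _ => φ) fun _ => hφ
  have := hfin 0 _ hweight
  rw [klDensity, htrue, hmodel,
    ← map_withDensity_of_leftInverse hT hS hST (measurable_mixtureDensity hκ _ _),
    ← map_withDensity_of_leftInverse hT hS hST (measurable_mixtureDensity hκ _ _)]
  exact klDiv_map_le _ _ hT.measurable

lemma IsCovKernel.gram_posSemidef (hK : IsCovKernel K) : (gram K X).PosSemidef :=
  PosSemidef.submatrix hK X

lemma RKHSNormLE.sq_dotProduct_le (h : RKHSNormLE K τ₀ B) (a : Fin n → ℝ) :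
    (a ⬝ᵥ fun i => τ₀ (X i)) ^ 2 ≤ B ^ 2 * (a ⬝ᵥ (gram K X *ᵥ a)) := by
  obtain ⟨F, _, _, _, _, hK, g, rfl, hB⟩ := h
  set v : F := ∑ i, a i • RKHS.kerFun F (X i) (1 : ℝ)
  have hinner : inner ℝ v g = a ⬝ᵥ fun i => g (X i) := by
    simp [v, sum_inner, real_inner_smul_left, dotProduct]
  have hnorm : ‖v‖ ^ 2 = a ⬝ᵥ (gram K X *ᵥ a) := by
    rw [← real_inner_self_eq_norm_sq]
    simp only [v, sum_inner, inner_sum, real_inner_smul_left, real_inner_smul_right, dotProduct,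
      mulVec, gram, of_apply, Finset.mul_sum]
    refine Finset.sum_congr rfl fun i _ => Finset.sum_congr rfl fun j _ => ?_
    rw [← RKHS.kernel_inner, hK]
    simp only [RCLike.inner_apply, conj_trivial, one_mul]
    ring
  rw [← hinner, ← hnorm, ← mul_pow, mul_comm B, sq_le_sq]
  refine (abs_real_inner_le_norm v g).trans (le_trans ?_ (le_abs_self _))
  gcongr

lemma dotProduct_gram_mulVec_le (hδ : ∀ x x', |K x x' - C x x'| ≤ δ) (a : Fin n → ℝ) :
    a ⬝ᵥ (gram C X *ᵥ a) ≤ a ⬝ᵥ (gram K X *ᵥ a) + n * δ * (a ⬝ᵥ a) := by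
  rcases isEmpty_or_nonempty (Fin n) with _ | ⟨⟨i₀⟩⟩
  · simp [dotProduct]
  have hδ₀ : 0 ≤ δ := (abs_nonneg _).trans (hδ (X i₀) (X i₀))
  have hentry : ∀ i j, a i * (C (X i) (X j) * a j) - a i * (K (X i) (X j) * a j) ≤
      |a i| * |a j| * δ := fun i j => by
    calc a i * (C (X i) (X j) * a j) - a i * (K (X i) (X j) * a j)
        = -(a i * a j * (K (X i) (X j) - C (X i) (X j))) := by ring
      _ ≤ |a i * a j * (K (X i) (X j) - C (X i) (X j))| := neg_le_abs _
      _ ≤ |a i| * |a j| * δ := by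
        rw [abs_mul, abs_mul]
        gcongr
        exact hδ _ _
  have hsum : (∑ i, |a i|) ^ 2 ≤ n * (a ⬝ᵥ a) := by
    simpa [dotProduct, sq] using
      sq_sum_le_card_mul_sum_sq (s := Finset.univ) (f := fun i => |a i|)
  rw [← sub_le_iff_le_add']
  calc a ⬝ᵥ (gram C X *ᵥ a) - a ⬝ᵥ (gram K X *ᵥ a)
      = ∑ i, ∑ j, (a i * (C (X i) (X j) * a j) - a i * (K (X i) (X j) * a j)) := by
        simp only [dotProduct, mulVec, gram, of_apply, Finset.mul_sum, Finset.sum_sub_distrib]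
    _ ≤ ∑ i, ∑ j, |a i| * |a j| * δ :=
        Finset.sum_le_sum fun i _ => Finset.sum_le_sum fun j _ => hentry i j
    _ = (∑ i, |a i|) ^ 2 * δ := by
        rw [sq, Finset.sum_mul_sum]
        simp only [Finset.sum_mul]
    _ ≤ n * (a ⬝ᵥ a) * δ := by gcongr
    _ = n * δ * (a ⬝ᵥ a) := by ring

lemma sum_sq_div_le_of_RKHSNormLE (hK : IsCovKernel K) (hτ : RKHSNormLE C τ₀ B) (hφ : 0 < φ)
    (hδ₀ : 0 ≤ δ) (hδ : ∀ x x', |K x x' - C x x'| ≤ δ) {O : Matrix (Fin n) (Fin n) ℝ}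
    {l : Fin n → ℝ} (hO : Oᵀ * O = 1) (hl : ∀ i, 0 ≤ l i)
    (hgram : gram K X = O * diagonal l * Oᵀ) :
    ∑ i, (Oᵀ *ᵥ fun i => τ₀ (X i)) i ^ 2 / (l i + φ) ≤ B ^ 2 * (1 + n * δ / φ) := by
  refine sum_sq_div_le_of_quadratic_form_le hO hl hφ (by positivity) _ fun a => ?_
  rw [← hgram]
  set k := a ⬝ᵥ (gram K X *ᵥ a)
  have hk : 0 ≤ k := by simpa using (hK.gram_posSemidef X).dotProduct_mulVec_nonneg a
  calc (a ⬝ᵥ fun i => τ₀ (X i)) ^ 2 ≤ B ^ 2 * (a ⬝ᵥ (gram C X *ᵥ a)) := hτ.sq_dotProduct_le X a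
    _ ≤ B ^ 2 * (k + n * δ * (a ⬝ᵥ a)) := by
        gcongr
        exact dotProduct_gram_mulVec_le X hδ a
    _ ≤ B ^ 2 * ((1 + n * δ / φ) * (k + φ * (a ⬝ᵥ a))) := by
        have hnoise : 0 ≤ φ * (a ⬝ᵥ a) :=
          mul_nonneg hφ.le (by simpa using dotProduct_self_star_nonneg a)
        have hcross : 0 ≤ n * δ / φ * k := by positivity
        have hexpand : (1 + n * δ / φ) * (k + φ * (a ⬝ᵥ a)) =
            k + n * δ * (a ⬝ᵥ a) + (φ * (a ⬝ᵥ a) + n * δ / φ * k) := by field_simp; ring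
        gcongr
        linarith
    _ = B ^ 2 * (1 + n * δ / φ) * (k + φ * (a ⬝ᵥ a)) := by ring

lemma klDensity_le [IsProbabilityMeasure H] (hκ : Measurable κ) (hκ₀ : ∀ᵐ r ∂H, 0 < κ r)
    (hφ : 0 < φ) (hK : IsCovKernel K) (hτ : RKHSNormLE C τ₀ B) (hδ₀ : 0 ≤ δ)
    (hδ : ∀ x x', |K x x' - C x x'| ≤ δ) {a b ε : ℝ} (hε : 0 < ε) (hεa : ε ≤ a) (hab : a ≤ b)
    (hH : H (κ ⁻¹' Set.Icc a b) ≠ 0) (m : Fin n → ℝ) :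
    klDensity (trueDensity H κ φ τ₀ m X) (modelDensity H κ φ K m X) ≤
      ENNReal.ofReal (Real.log (1 + φ⁻¹ • gram K X).det) +
        n * (ENNReal.ofReal (B ^ 2 / (φ * ε) * δ) +
          ∫⁻ r in {r | κ r < ε}, ENNReal.ofReal (Real.log b - Real.log (κ r)) ∂H) +
        (ENNReal.ofReal (B ^ 2 / ε) + ENNReal.ofReal (Real.log 2) +
          ENNReal.ofReal (-Real.log (H.real (κ ⁻¹' Set.Icc a b))) + 1) := by
  obtain ⟨O, l, hO, hl, hgram⟩ := exists_orthogonal_diagonalization (hK.gram_posSemidef X)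
  have hsignal : ENNReal.ofReal ((∑ i, (Oᵀ *ᵥ fun i => τ₀ (X i)) i ^ 2 / (l i + φ)) / ε) ≤
      ENNReal.ofReal (B ^ 2 / ε) + n * ENNReal.ofReal (B ^ 2 / (φ * ε) * δ) := by
    rw [← ENNReal.ofReal_natCast n, ← ENNReal.ofReal_mul (Nat.cast_nonneg n),
      ← ENNReal.ofReal_add (by positivity) (by positivity)]
    refine ENNReal.ofReal_le_ofReal ?_
    calc _ ≤ B ^ 2 * (1 + n * δ / φ) / ε := by
          gcongr
          exact sum_sq_div_le_of_RKHSNormLE X hK hτ hφ hδ₀ hδ hO hl hgram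
      _ = _ := by field_simp
  rw [hgram, det_one_add_smul_of_diagonalization hO]
  calc klDensity (trueDensity H κ φ τ₀ m X) (modelDensity H κ φ K m X)
      ≤ ENNReal.ofReal (Real.log (∏ i, (1 + φ⁻¹ * l i))) +
          ENNReal.ofReal ((∑ i, (Oᵀ *ᵥ fun i => τ₀ (X i)) i ^ 2 / (l i + φ)) / ε) +
          ENNReal.ofReal (Real.log 2) +
          (n * ∫⁻ r in {r | κ r < ε}, ENNReal.ofReal (Real.log b - Real.log (κ r)) ∂H +
            ENNReal.ofReal (-Real.log (H.real (κ ⁻¹' Set.Icc a b)))) + 1 :=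
        (klDensity_le_klDiv_mixtureDensity X hκ hκ₀ hφ m hO hl hgram).trans
          (klDiv_mixtureDensity_le hκ hκ₀ hφ _ hl hε hεa hab hH)
    _ ≤ ENNReal.ofReal (Real.log (∏ i, (1 + φ⁻¹ * l i))) +
          (ENNReal.ofReal (B ^ 2 / ε) + n * ENNReal.ofReal (B ^ 2 / (φ * ε) * δ)) +
          ENNReal.ofReal (Real.log 2) +
          (n * ∫⁻ r in {r | κ r < ε}, ENNReal.ofReal (Real.log b - Real.log (κ r)) ∂H +
            ENNReal.ofReal (-Real.log (H.real (κ ⁻¹' Set.Icc a b)))) + 1 := by gcongr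
    _ = _ := by ring

end PointwiseBound

section Asymptotics

lemma tendsto_const_div_natCast {D : ℝ≥0∞} (hD : D ≠ ∞) :
    Tendsto (fun n : ℕ => D / n) atTop (𝓝 0) := by
  simpa using ENNReal.Tendsto.const_div ENNReal.tendsto_nat_nhds_top (.inr hD)

lemma exists_pos_ofReal_mul_le (c : ℝ) {e : ℝ≥0∞} (he : 0 < e) :
    ∃ δ : ℝ, 0 < δ ∧ ENNReal.ofReal (c * δ) ≤ e := by
  have hlim : Tendsto (fun δ : ℝ => ENNReal.ofReal (c * δ)) (𝓝[>] 0) (𝓝 0) := by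
    have hcont : Continuous fun δ : ℝ => ENNReal.ofReal (c * δ) :=
      ENNReal.continuous_ofReal.comp (continuous_const.mul continuous_id)
    simpa using (hcont.tendsto 0).mono_left nhdsWithin_le_nhds
  obtain ⟨δ, hδe, hδ⟩ := ((ENNReal.tendsto_nhds_zero.1 hlim e he).and self_mem_nhdsWithin).exists
  exact ⟨δ, hδ, hδe⟩

variable {u : ℕ → ℝ≥0∞}

lemma le_mul_add_of_subadditive (hu : ∀ m k, u (m + k) ≤ u m + u k) (m j q : ℕ) :
    u (q * m + j) ≤ q * u m + u j := by
  induction q with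
  | zero => simp
  | succ q ih =>
    calc u ((q + 1) * m + j) = u (m + (q * m + j)) := by congr 1; ring
      _ ≤ u m + (q * u m + u j) := (hu m _).trans (by gcongr)
      _ = (q + 1 : ℕ) * u m + u j := by push_cast; ring

lemma div_natCast_le_of_subadditive (hu : ∀ m k, u (m + k) ≤ u m + u k) {m n : ℕ} (hm : 0 < m)
    (hmn : m ≤ n) : u n / n ≤ u m / m + (∑ j ∈ Finset.Ico m (2 * m), u j) / n := by
  obtain ⟨q, j, hj, rfl⟩ : ∃ q, ∃ j ∈ Finset.Ico m (2 * m), n = q * m + j := by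
    refine ⟨n / m - 1, m + n % m, ?_, ?_⟩
    · have := Nat.mod_lt n hm
      rw [Finset.mem_Ico]
      omega
    · obtain ⟨q, hq⟩ := Nat.exists_eq_add_of_le' (Nat.div_pos hmn hm)
      have hdiv := Nat.div_add_mod n m
      rw [hq] at hdiv ⊢
      rw [Nat.add_sub_cancel]
      linarith
  have hm₀ : (m : ℝ≥0∞) ≠ 0 := by exact_mod_cast hm.ne'
  have hn₀ : ((q * m + j : ℕ) : ℝ≥0∞) ≠ 0 := by
    exact_mod_cast (hm.trans_le hmn).ne'
  have hblocks : q * u m / (q * m + j : ℕ) ≤ u m / m := by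
    rw [ENNReal.div_le_iff hn₀ (ENNReal.natCast_ne_top _)]
    calc q * u m = u m / m * (q * m : ℕ) := by
          rw [Nat.cast_mul, mul_comm (q : ℝ≥0∞) m, ← mul_assoc,
            ENNReal.div_mul_cancel hm₀ (ENNReal.natCast_ne_top m), mul_comm]
      _ ≤ u m / m * (q * m + j : ℕ) := by gcongr; exact Nat.le_add_right _ _
  calc u (q * m + j) / (q * m + j : ℕ)
      ≤ (q * u m + ∑ j ∈ Finset.Ico m (2 * m), u j) / (q * m + j : ℕ) := by
        gcongr
        exact (le_mul_add_of_subadditive hu m j q).trans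
          (by gcongr; exact Finset.single_le_sum (fun _ _ => zero_le) hj)
    _ ≤ _ := by
        rw [ENNReal.add_div]
        gcongr

end Asymptotics

section Regret

open Matrix

variable {𝒳 : Type} {K C : 𝒳 → 𝒳 → ℝ} {φ δ : ℝ}

lemma log_det_one_add_gram_add_le (hK : IsCovKernel K) (hφ : 0 ≤ φ) {m k : ℕ}
    (X : Fin (m + k) → 𝒳) :
    Real.log (1 + φ⁻¹ • gram K X).det ≤
      Real.log (1 + φ⁻¹ • gram K fun i => X (Fin.castAdd k i)).det +
        Real.log (1 + φ⁻¹ • gram K fun i => X (Fin.natAdd m i)).det := by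
  set A := (1 + φ⁻¹ • gram K X).submatrix finSumFinEquiv finSumFinEquiv
  have hA : A.PosDef := (PosDef.one.add_posSemidef
    ((hK.gram_posSemidef X).smul (inv_nonneg.2 hφ))).submatrix finSumFinEquiv.injective
  have hA₁ : A.toBlocks₁₁ = 1 + φ⁻¹ • gram K fun i => X (Fin.castAdd k i) := by
    ext i j
    simp [A, toBlocks₁₁, gram, one_apply]
  have hA₂ : A.toBlocks₂₂ = 1 + φ⁻¹ • gram K fun i => X (Fin.natAdd m i) := by
    ext i j
    simp [A, toBlocks₂₂, gram, one_apply]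
  have hfischer := log_det_le_log_det_toBlocks_add hA
  rwa [hA₁, hA₂, det_submatrix_equiv_self] at hfischer

lemma log_det_one_add_gram_le_of_abs_sub_le (hK : IsCovKernel K) (hC : IsCovKernel C)
    (hφ : 0 ≤ φ) (hδ : ∀ x x', |K x x' - C x x'| ≤ δ) {n : ℕ} (X : Fin n → 𝒳) :
    Real.log (1 + φ⁻¹ • gram K X).det ≤
      Real.log (1 + φ⁻¹ • gram C X).det + n ^ 2 * (φ⁻¹ * δ) := by
  have hφ' : 0 ≤ φ⁻¹ := inv_nonneg.2 hφ
  refine (log_det_one_add_le_of_abs_sub_le (d := φ⁻¹ * δ) ((hC.gram_posSemidef X).smul hφ')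
    ((hK.gram_posSemidef X).smul hφ') fun i j => ?_).trans_eq (by rw [Fintype.card_fin])
  simp only [Matrix.smul_apply, gram, of_apply, smul_eq_mul]
  rw [← mul_sub, abs_mul, abs_of_nonneg hφ']
  exact mul_le_mul_of_nonneg_left (hδ _ _) hφ'

variable [MeasurableSpace 𝒳] {U : Measure 𝒳}

lemma measurePreserving_pi_comp [IsProbabilityMeasure U] {ι ι' : Type*} [Fintype ι] [Fintype ι']
    {e : ι' → ι} (he : Function.Injective e) :
    MeasurePreserving (fun (X : ι → 𝒳) i => X (e i)) (Measure.pi fun _ => U)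
      (Measure.pi fun _ => U) := by
  have hindep : iIndepFun (fun (i : ι) (X : ι → 𝒳) => X i) (Measure.pi fun _ => U) :=
    iIndepFun_pi (X := fun _ x => x) fun _ => aemeasurable_id
  refine ⟨by fun_prop, ?_⟩
  rw [(iIndepFun_iff_map_fun_eq_pi_map
    fun i => (measurable_pi_apply (e i)).aemeasurable).1 (hindep.precomp he)]
  exact congrArg Measure.pi (funext fun i => (measurePreserving_eval (fun _ : ι => U) (e i)).map_eq)

lemma measurable_log_det_one_add_gram (hK : Measurable (Function.uncurry K)) (φ : ℝ) (n : ℕ) :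
    Measurable fun X : Fin n → 𝒳 => ENNReal.ofReal (Real.log (1 + φ⁻¹ • gram K X).det) := by
  have hentry : ∀ i j, Measurable fun X : Fin n → 𝒳 => K (X i) (X j) := fun i j =>
    hK.comp (show Measurable fun X : Fin n → 𝒳 => (X i, X j) by fun_prop)
  refine (Real.measurable_log.comp ?_).ennreal_ofReal
  simp only [det_apply]
  exact Finset.measurable_sum _ fun σ _ => (Finset.measurable_prod _ fun i _ =>
    measurable_const.add (measurable_const.mul (hentry (σ i) i))).const_smul _

lemma expectedRegret_le_of_abs_sub_le [IsProbabilityMeasure U] (hK : IsCovKernel K)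
    (hC : IsCovKernel C) (hφ : 0 ≤ φ) (hδ : ∀ x x', |K x x' - C x x'| ≤ δ) (n : ℕ) :
    expectedRegret U φ K n ≤ expectedRegret U φ C n + ENNReal.ofReal (n ^ 2 * (φ⁻¹ * δ)) := by
  calc expectedRegret U φ K n
      ≤ ∫⁻ X : Fin n → 𝒳, (ENNReal.ofReal (Real.log (1 + φ⁻¹ • gram C X).det) +
          ENNReal.ofReal (n ^ 2 * (φ⁻¹ * δ))) ∂(Measure.pi fun _ => U) :=
        lintegral_mono fun X => (ENNReal.ofReal_le_ofReal
          (log_det_one_add_gram_le_of_abs_sub_le hK hC hφ hδ X)).trans ENNReal.ofReal_add_le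
    _ = _ := by
        rw [lintegral_add_right _ measurable_const, lintegral_const, measure_univ, mul_one]
        rfl

lemma expectedRegret_add_le [IsProbabilityMeasure U] (hK : IsCovKernel K)
    (hKm : Measurable (Function.uncurry K)) (hφ : 0 ≤ φ) (m k : ℕ) :
    expectedRegret U φ K (m + k) ≤ expectedRegret U φ K m + expectedRegret U φ K k := by
  have hfst := measurePreserving_pi_comp (U := U) (Fin.castAdd_injective m k)
  have hsnd := measurePreserving_pi_comp (U := U) (Fin.natAdd_injective k m)
  have hmeas : Measurable fun X : Fin (m + k) → 𝒳 =>
      ENNReal.ofReal (Real.log (1 + φ⁻¹ • gram K fun i => X (Fin.castAdd k i)).det) :=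
    (measurable_log_det_one_add_gram hKm φ m).comp hfst.measurable
  calc expectedRegret U φ K (m + k)
      ≤ ∫⁻ X : Fin (m + k) → 𝒳,
          (ENNReal.ofReal (Real.log (1 + φ⁻¹ • gram K fun i => X (Fin.castAdd k i)).det) +
            ENNReal.ofReal (Real.log (1 + φ⁻¹ • gram K fun i => X (Fin.natAdd m i)).det))
          ∂(Measure.pi fun _ => U) :=
        lintegral_mono fun X => (ENNReal.ofReal_le_ofReal
          (log_det_one_add_gram_add_le hK hφ X)).trans ENNReal.ofReal_add_le
    _ = expectedRegret U φ K m + expectedRegret U φ K k := by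
        rw [lintegral_add_left hmeas, expectedRegret, expectedRegret,
          ← hfst.lintegral_comp (measurable_log_det_one_add_gram hKm φ m),
          ← hsnd.lintegral_comp (measurable_log_det_one_add_gram hKm φ k)]

lemma expectedRegret_ne_top_of_div_le_one {n : ℕ} (h : expectedRegret U φ C n / n ≤ 1) :
    expectedRegret U φ C n ≠ ∞ := by
  intro htop
  rw [htop, ENNReal.top_div_of_ne_top (ENNReal.natCast_ne_top n)] at h
  exact absurd h (by simp)

lemma tendsto_expectedRegret_div [IsProbabilityMeasure U] {K : ℕ → 𝒳 → 𝒳 → ℝ}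
    (hK : ∀ n, IsCovKernel (K n)) (hKm : ∀ n, Measurable (Function.uncurry (K n)))
    (hC : IsCovKernel C) (hφ : 0 ≤ φ)
    (hunif : ∀ δ > 0, ∀ᶠ n in atTop, ∀ x x', |K n x x' - C x x'| ≤ δ)
    (hreg : Tendsto (fun n : ℕ => expectedRegret U φ C n / n) atTop (𝓝 0)) :
    Tendsto (fun n : ℕ => expectedRegret U φ (K n) n / n) atTop (𝓝 0) := by
  rw [ENNReal.tendsto_nhds_zero] at hreg ⊢
  intro e he
  have he₃ : 0 < e / 3 := ENNReal.div_pos he.ne' (by simp)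
  obtain ⟨m, hm⟩ := eventually_atTop.1
    (((hreg 1 one_pos).and (hreg (e / 3) he₃)).and (eventually_gt_atTop 0))
  obtain ⟨⟨-, hCm⟩, hm₀⟩ := hm m le_rfl
  obtain ⟨δ, hδ, hδe⟩ := exists_pos_ofReal_mul_le (m * φ⁻¹) he₃
  set R : ℕ → ℝ≥0∞ := fun j => expectedRegret U φ C j + ENNReal.ofReal (j ^ 2 * (φ⁻¹ * δ))
  have hR_sum : ∑ j ∈ Finset.Ico m (2 * m), R j ≠ ∞ :=
    ENNReal.sum_ne_top.2 fun j hj => ENNReal.add_ne_top.2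
      ⟨expectedRegret_ne_top_of_div_le_one (hm j (Finset.mem_Ico.1 hj).1).1.1,
        ENNReal.ofReal_ne_top⟩
  have hR_m : R m / m ≤ e / 3 + e / 3 := by
    have hm₀' : (0 : ℝ) < m := by exact_mod_cast hm₀
    have hcancel : (m : ℝ) ^ 2 * (φ⁻¹ * δ) / m = m * φ⁻¹ * δ := by field_simp
    rw [ENNReal.add_div, ← ENNReal.ofReal_natCast m, ← ENNReal.ofReal_div_of_pos hm₀', hcancel,
      ENNReal.ofReal_natCast]
    gcongr
  filter_upwards [hunif δ hδ,
    ENNReal.tendsto_nhds_zero.1 (tendsto_const_div_natCast hR_sum) _ he₃,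
    eventually_ge_atTop m] with n hKC hremainder hmn
  have hKR : ∀ j, expectedRegret U φ (K n) j ≤ R j :=
    expectedRegret_le_of_abs_sub_le (hK n) hC hφ hKC
  calc expectedRegret U φ (K n) n / n
      ≤ expectedRegret U φ (K n) m / m +
          (∑ j ∈ Finset.Ico m (2 * m), expectedRegret U φ (K n) j) / n :=
        div_natCast_le_of_subadditive (expectedRegret_add_le (hK n) (hKm n) hφ) hm₀ hmn
    _ ≤ R m / m + (∑ j ∈ Finset.Ico m (2 * m), R j) / n := by
        gcongr
        · exact hKR m
        · exact hKR _
    _ ≤ e / 3 + e / 3 + e / 3 := by gcongr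
    _ = e := ENNReal.add_thirds e

end Regret

section ScaleTail

variable {H : Measure ℝ} {κ : ℝ → ℝ}

lemma exists_measure_preimage_Icc_ne_zero [NeZero H] (hκ₀ : ∀ᵐ r ∂H, 0 < κ r) :
    ∃ a b : ℝ, 0 < a ∧ a ≤ b ∧ H (κ ⁻¹' Set.Icc a b) ≠ 0 := by
  set s : ℕ → Set ℝ := fun k => κ ⁻¹' Set.Icc (1 / (k + 1)) (k + 1)
  have hcover : ∀ᵐ r ∂H, r ∈ ⋃ k, s k := by
    filter_upwards [hκ₀] with r hr
    obtain ⟨k₁, hk₁⟩ := exists_nat_one_div_lt hr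
    obtain ⟨k₂, hk₂⟩ := exists_nat_ge (κ r)
    refine Set.mem_iUnion.2 ⟨max k₁ k₂, (Nat.one_div_le_one_div (le_max_left k₁ k₂)).trans hk₁.le,
      hk₂.trans ?_⟩
    exact_mod_cast (le_max_right k₁ k₂).trans (Nat.le_succ _)
  have hunion : H (⋃ k, s k) ≠ 0 := by
    have hfull : H (⋃ k, s k) = H Set.univ := measure_congr (eventuallyEq_univ.2 hcover)
    rw [hfull, Measure.measure_univ_ne_zero]
    exact NeZero.ne H
  obtain ⟨k, hk⟩ := exists_measure_pos_of_not_measure_iUnion_null hunion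
  have hk₁ : (1 : ℝ) ≤ k + 1 := le_add_of_nonneg_left k.cast_nonneg
  exact ⟨1 / (k + 1), k + 1, by positivity, (div_le_self zero_le_one hk₁).trans hk₁, hk.ne'⟩

lemma tendsto_measure_lt_nhdsGT_zero [IsFiniteMeasure H] (hκ : Measurable κ)
    (hκ₀ : ∀ᵐ r ∂H, 0 < κ r) : Tendsto (fun ε => H {r | κ r < ε}) (𝓝[>] 0) (𝓝 0) := by
  rw [← measure_empty (μ := H)]
  refine tendsto_measure_of_ae_tendsto_indicator_of_isFiniteMeasure _ .empty
    (fun ε => measurableSet_lt hκ measurable_const) ?_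
  filter_upwards [hκ₀] with r hr
  filter_upwards [nhdsWithin_le_nhds (eventually_lt_nhds hr)] with ε hε
  simpa using hε.le

lemma tendsto_setLIntegral_log_sub_log_nhdsGT_zero [IsFiniteMeasure H] (hκ : Measurable κ)
    (hκ₀ : ∀ᵐ r ∂H, 0 < κ r) (hκlog : ∫⁻ r, ENNReal.ofReal (-Real.log (κ r)) ∂H < ∞) (b : ℝ) :
    Tendsto (fun ε => ∫⁻ r in {r | κ r < ε}, ENNReal.ofReal (Real.log b - Real.log (κ r)) ∂H)
      (𝓝[>] 0) (𝓝 0) := by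
  refine tendsto_setLIntegral_zero (ne_of_lt ?_) (tendsto_measure_lt_nhdsGT_zero hκ hκ₀)
  calc ∫⁻ r, ENNReal.ofReal (Real.log b - Real.log (κ r)) ∂H
      ≤ ∫⁻ r, (ENNReal.ofReal (Real.log b) + ENNReal.ofReal (-Real.log (κ r))) ∂H :=
        lintegral_mono fun r => by rw [sub_eq_add_neg]; exact ENNReal.ofReal_add_le
    _ = ENNReal.ofReal (Real.log b) * H Set.univ + ∫⁻ r, ENNReal.ofReal (-Real.log (κ r)) ∂H := by
        rw [lintegral_add_left measurable_const, lintegral_const]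
    _ < ∞ := by finiteness

end ScaleTail

section Consistency

variable {𝒳 : Type} [MeasurableSpace 𝒳] {U : Measure 𝒳} [IsProbabilityMeasure U] {H : Measure ℝ}
  [IsProbabilityMeasure H] {κ : ℝ → ℝ} {φ : ℝ} {τ₀ : 𝒳 → ℝ} {C : 𝒳 → 𝒳 → ℝ} {B : ℝ}

lemma expectedKL_le {K : 𝒳 → 𝒳 → ℝ} {n : ℕ} (hκ : Measurable κ) (hκ₀ : ∀ᵐ r ∂H, 0 < κ r)
    (hφ : 0 < φ) (hK : IsCovKernel K) (hτ : RKHSNormLE C τ₀ B) {δ : ℝ} (hδ₀ : 0 ≤ δ)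
    (hδ : ∀ x x', |K x x' - C x x'| ≤ δ) {a b ε : ℝ} (hε : 0 < ε) (hεa : ε ≤ a) (hab : a ≤ b)
    (hH : H (κ ⁻¹' Set.Icc a b) ≠ 0) (m : Fin n → ℝ) :
    expectedKL U H κ φ τ₀ K m ≤
      expectedRegret U φ K n +
        n * (ENNReal.ofReal (B ^ 2 / (φ * ε) * δ) +
          ∫⁻ r in {r | κ r < ε}, ENNReal.ofReal (Real.log b - Real.log (κ r)) ∂H) +
        (ENNReal.ofReal (B ^ 2 / ε) + ENNReal.ofReal (Real.log 2) +
          ENNReal.ofReal (-Real.log (H.real (κ ⁻¹' Set.Icc a b))) + 1) := by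
  refine (lintegral_mono fun X =>
    klDensity_le X hκ hκ₀ hφ hK hτ hδ₀ hδ hε hεa hab hH m).trans_eq ?_
  simp only [lintegral_add_right _ measurable_const, lintegral_const, measure_univ, mul_one]
  rfl

lemma tendsto_expectedKL_div (hκ : Measurable κ) (hκ₀ : ∀ᵐ r ∂H, 0 < κ r)
    (hκlog : ∫⁻ r, ENNReal.ofReal (-Real.log (κ r)) ∂H < ∞) (hφ : 0 < φ)
    {K : ℕ → 𝒳 → 𝒳 → ℝ} (hK : ∀ n, IsCovKernel (K n))
    (hKm : ∀ n, Measurable (Function.uncurry (K n))) (hC : IsCovKernel C)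
    (hunif : ∀ δ > 0, ∀ᶠ n in atTop, ∀ x x', |K n x x' - C x x'| ≤ δ)
    (hτ : RKHSNormLE C τ₀ B)
    (hreg : Tendsto (fun n : ℕ => expectedRegret U φ C n / n) atTop (𝓝 0))
    (m : (n : ℕ) → Fin n → ℝ) :
    Tendsto (fun n : ℕ => expectedKL U H κ φ τ₀ (K n) (m n) / n) atTop (𝓝 0) := by
  have hregK := tendsto_expectedRegret_div hK hKm hC hφ.le hunif hreg
  rw [ENNReal.tendsto_nhds_zero] at hregK ⊢
  intro e he
  have he₄ : 0 < e / 4 := ENNReal.div_pos he.ne' (by simp)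
  obtain ⟨a, b, ha, hab, hH⟩ := exists_measure_preimage_Icc_ne_zero hκ₀
  obtain ⟨ε, hW, hε, hεa⟩ := ((ENNReal.tendsto_nhds_zero.1
    (tendsto_setLIntegral_log_sub_log_nhdsGT_zero hκ hκ₀ hκlog b) _ he₄).and
    (Ioc_mem_nhdsGT ha)).exists
  obtain ⟨δ, hδ, hδe⟩ := exists_pos_ofReal_mul_le (B ^ 2 / (φ * ε)) he₄
  set W := ∫⁻ r in {r | κ r < ε}, ENNReal.ofReal (Real.log b - Real.log (κ r)) ∂H
  set D : ℝ≥0∞ := ENNReal.ofReal (B ^ 2 / ε) + ENNReal.ofReal (Real.log 2) +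
    ENNReal.ofReal (-Real.log (H.real (κ ⁻¹' Set.Icc a b))) + 1
  have hD : D ≠ ∞ := by finiteness
  filter_upwards [hunif δ hδ, hregK _ he₄,
    ENNReal.tendsto_nhds_zero.1 (tendsto_const_div_natCast hD) _ he₄,
    eventually_ne_atTop 0] with n hKC hregret hDn hn
  calc expectedKL U H κ φ τ₀ (K n) (m n) / n
      ≤ (expectedRegret U φ (K n) n + n * (ENNReal.ofReal (B ^ 2 / (φ * ε) * δ) + W) + D) / n := by
        gcongr
        exact expectedKL_le hκ hκ₀ hφ (hK n) hτ hδ.le hKC hε hεa hab hH (m n)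
    _ = expectedRegret U φ (K n) n / n + (ENNReal.ofReal (B ^ 2 / (φ * ε) * δ) + W) + D / n := by
        rw [ENNReal.add_div, ENNReal.add_div, mul_comm (n : ℝ≥0∞), ENNReal.mul_div_cancel_right
          (Nat.cast_ne_zero.2 hn) (ENNReal.natCast_ne_top n)]
    _ ≤ e / 4 + (e / 4 + e / 4) + e / 4 := by gcongr
    _ = 4 * (e / 4) := by ring
    _ = e := ENNReal.mul_div_cancel (by simp) (by simp)

end Consistency

end HPFR

end

theorem theorem1_general
    {𝒳 : Type} [MeasurableSpace 𝒳] (U : Measure 𝒳) [IsProbabilityMeasure U]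
    {Θ : Type*} [TopologicalSpace Θ] (C : Θ → 𝒳 → 𝒳 → ℝ)
    (hCcov : ∀ θ, HPFR.IsCovKernel (C θ))
    (hCmeas : ∀ θ, Measurable (Function.uncurry (C θ)))
    (H : Measure ℝ) [IsProbabilityMeasure H] (κ : ℝ → ℝ) (hκmeas : Measurable κ)
    (hκpos : ∀ᵐ r ∂H, 0 < κ r)
    (hκlog : ∫⁻ r, ENNReal.ofReal (-Real.log (κ r)) ∂H < ∞)
    (φ : ℝ) (hφ : 0 < φ) (m : (n : ℕ) → Fin n → ℝ) (τ₀ : 𝒳 → ℝ) (θ₀ : Θ)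
    {Ω : Type*} [MeasurableSpace Ω] (P : Measure Ω) (θhat : ℕ → Ω → Θ)
    (hCcont : TendstoUniformly (fun θ => Function.uncurry (C θ)) (Function.uncurry (C θ₀)) (𝓝 θ₀))
    (hθhat : ∀ᵐ ω ∂P, Tendsto (fun n => θhat n ω) atTop (𝓝 θ₀))
    (hτ₀ : ∃ B : ℝ, HPFR.RKHSNormLE (C θ₀) τ₀ B)
    (hregret : Tendsto (fun n : ℕ => HPFR.expectedRegret U φ (C θ₀) n / n) atTop (𝓝 0)) :
    ∀ᵐ ω ∂P, Tendsto (fun n : ℕ => HPFR.expectedKL U H κ φ τ₀ (C (θhat n ω)) (m n) / n)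
      atTop (𝓝 0) := by
  obtain ⟨B, hB⟩ := hτ₀
  filter_upwards [hθhat] with ω hω
  have hunif : ∀ δ > 0, ∀ᶠ n in atTop, ∀ x x', |C (θhat n ω) x x' - C θ₀ x x'| ≤ δ := by
    intro δ hδ
    filter_upwards [hω.eventually (Metric.tendstoUniformly_iff.1 hCcont δ hδ)] with n hn x x'
    rw [← Real.dist_eq, dist_comm]
    exact (hn (x, x')).le
  exact HPFR.tendsto_expectedKL_div hκmeas hκpos hκlog hφ (fun n => hCcov _) (fun n => hCmeas _)
    (hCcov θ₀) hunif hB hregret m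

theorem theorem1
    {p : ℕ} (𝒳 : Set (EuclideanSpace ℝ (Fin p)))
    (U : Measure 𝒳) [IsProbabilityMeasure U]
    {Θ : Type*} [TopologicalSpace Θ]
    (C : Θ → 𝒳 → 𝒳 → ℝ)
    (hCcov : ∀ θ, HPFR.IsCovKernel (C θ))
    (hCmeas : ∀ θ, Measurable (Function.uncurry (C θ)))
    (H : Measure ℝ) [IsProbabilityMeasure H] (hH : ∀ᵐ r ∂H, 0 < r)
    (κ : ℝ → ℝ) (hκmeas : Measurable κ) (hκpos : ∀ r, 0 < r → 0 < κ r)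
    (hκlog : ∫⁻ r, ENNReal.ofReal (-Real.log (κ r)) ∂H < ∞)
    (φ : ℝ) (hφ : 0 < φ)
    (μ : ℝ → ℝ) (t : (n : ℕ) → Fin n → ℝ)
    (τ₀ : 𝒳 → ℝ) (θ₀ : Θ)
    {Ω : Type*} [MeasurableSpace Ω] (P : Measure Ω) [IsProbabilityMeasure P]
    (θhat : ℕ → Ω → Θ)
    -- (C1)
    (hCcont : ∀ θ₁, TendstoUniformly (fun θ => Function.uncurry (C θ)) (Function.uncurry (C θ₁))
      (𝓝 θ₁))
    (hθhat : ∀ᵐ ω ∂P, Tendsto (fun n => θhat n ω) atTop (𝓝 θ₀))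
    -- (C2)
    (hτ₀ : ∃ B : ℝ, HPFR.RKHSNormLE (C θ₀) τ₀ B)
    -- (C3)
    (hregret : Tendsto (fun n : ℕ => HPFR.expectedRegret U φ (C θ₀) n / n) atTop (𝓝 0)) :
    ∀ᵐ ω ∂P, Tendsto
      (fun n : ℕ =>
        HPFR.expectedKL U H κ φ τ₀ (C (θhat n ω)) (fun i : Fin n => μ (t n i)) / n)
      atTop (𝓝 0) :=
  theorem1_general U C hCcov hCmeas H κ hκmeas (hH.mono hκpos) hκlog φ hφ (fun n i => μ (t n i)) τ₀
    θ₀ P θhat (hCcont θ₀) hθhat hτ₀ hregret
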